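/- Let $G$ be a finite group and $R$ a commutative ring with unity. A section of $G$ is a pair $(U,V)$ of subgroups with $V\trianglelefteq U\le G$, ordered by $(U,V)\preceq(M,L)$ iff $L\le V\le U\le M$. A collection of sections is a set of sections closed under conjugation. The orbit category of sections $\mathcal{D}_G$ has all sections of $G$ as objects, and its morphisms $(U,V)\to(M,L)$ are the cosets $Mg$ ($g\in G$) with ${}^g(U,V)\preceq(M,L)$; composition is $Nh\circ Mg=Nhg$. For a collection $\mathcal{C}$, $\mathcal{D}_G^{\mathcal{C}}$ is the full subcategory on the sections in $\mathcal{C}$. For a small category $\mathcal D$, an $R\mathcal{D}$-module is a contravariant functor from $\mathcal{D}$ to $R$-modules, and $H^n(\mathcal{D};F)=\mathrm{Ext}^n_{R\mathcal{D}}(\underline{R},F)$ with $\underline{R}$ the constant functor. For an $R\mathcal{D}_G$-module $F$ let $$r_G^F\colon F(G/1)\to\varprojlim_{(U,V)\in\mathcal{D}_G^{\mathcal{C}}}F(U/V)$$ be the map induced by the morphisms $(U,V)\to(G,1)$. The reduced cohomology $\widetilde H^n(\mathcal{D}_G^{\mathcal{C}};F)$ is $\ker r_G^F$ for $n=-1$,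 $\operatorname{coker} r_G^F$ for $n=0$, $H^n(\mathcal{D}_G^{\mathcal{C}};F)$ for $n\ge1$, and $0$ for $n<-1$. A biset functor for $G$ over $R$ is an $R$-linear functor to $R$-modules from the category whose objects are the groups $U/V$, indexed by the sections $(U,V)$ of $G$, and whose morphisms from $H$ to $K$ are the elements of $R\otimes_{\mathbb{Z}}B(K,H)$, where $B(K,H)$ is the Burnside group of finite $(K,H)$-bisets, with composition induced by $X\times_H Y$. It is an $R\mathcal{D}_G$-module through the destriction bisets $V\backslash g^{-1}M$ of the morphisms $Mg\colon(U,V)\to(M,L)$, and its obstruction group $\mathrm{Obs}^{\mathcal{C}}(F(G))$ is the cokernel of $r_G^F$. Let $\mathcal{C}'\subseteq\mathcal{C}$ be collections of sections of $G$, and let $i_*\colon\mathcal{D}_G^{\mathcal{C}'}\to\mathcal{D}_G^{\mathcal{C}}$ be the inclusion functor. Suppose that for every $w\in\mathcal{C}$ the poset $w\backslash i=\{w'\in\mathcal{C}'\mid w\preceq w'\}$ has contractible realization. Then: 1. for every $R\mathcal{D}_G^{\mathcal{C}}$-module $F$ and every $n\ge0$ there is an isomorphism $H^n(\mathcal{D}_G^{\mathcal{C}};F)\cong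 H^n(\mathcal{D}_G^{\mathcal{C}'};F\circ i_*)$; 2. for every $R\mathcal{D}_G$-module $F$ and every $n$ there is an isomorphism $\widetilde H^n(\mathcal{D}_G^{\mathcal{C}};F)\cong\widetilde H^n(\mathcal{D}_G^{\mathcal{C}'};F)$, where $F$ is restricted to the two subcategories; 3. for every biset functor $F$ for $G$ over $R$ there is an isomorphism $\mathrm{Obs}^{\mathcal{C}}(F(G))\cong\mathrm{Obs}^{\mathcal{C}'}(F(G))$. All isomorphisms are isomorphisms of $R$-modules. -/

import Mathlib

open CategoryTheory CategoryTheory.Limits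
open scoped Pointwise TensorProduct

universe u

noncomputable section

/-! ### Sections of a group -/

/-- A section `(U, V)` of `G`: subgroups `V ⊴ U ≤ G`, with `U = top` and `V = bot`. -/
@[ext]
structure Sec (G : Type u) [Group G] where
  top : Subgroup G
  bot : Subgroup G
  bot_le_top : bot ≤ top
  normal : (bot.subgroupOf top).Normal

namespace Sec

variable {G : Type u} [Group G]

attribute [instance] Sec.normal

/-- `(U, V) ≼ (M, L)` if and only if `L ≤ V ≤ U ≤ M`. -/
instance : PartialOrder (Sec G) where
  le S T := T.bot ≤ S.bot ∧ S.top ≤ T.top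
  le_refl _ := ⟨le_rfl, le_rfl⟩
  le_trans _ _ _ h k := ⟨k.1.trans h.1, h.2.trans k.2⟩
  le_antisymm _ _ h k := Sec.ext (le_antisymm h.2 k.2) (le_antisymm k.1 h.1)

theorem conj_mem_bot (S : Sec G) {u v : G} (hu : u ∈ S.top) (hv : v ∈ S.bot) :
    u * v * u⁻¹ ∈ S.bot := by
  have := S.normal.conj_mem ⟨v, S.bot_le_top hv⟩ (by simpa [Subgroup.mem_subgroupOf] using hv)
    ⟨u, hu⟩
  simpa [Subgroup.mem_subgroupOf] using this

/-- The conjugate section `(gUg⁻¹, gVg⁻¹)`. -/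
def conj (g : G) (S : Sec G) : Sec G where
  top := S.top.map (MulAut.conj g).toMonoidHom
  bot := S.bot.map (MulAut.conj g).toMonoidHom
  bot_le_top := Subgroup.map_mono S.bot_le_top
  normal := by
    constructor
    rintro ⟨_, hx⟩ ⟨v, hv, rfl⟩ ⟨_, ⟨u, hu, rfl⟩⟩
    exact ⟨u * v * u⁻¹, S.conj_mem_bot hu hv, by
      change g * (u * v * u⁻¹) * g⁻¹ = (g * u * g⁻¹) * (g * v * g⁻¹) * (g * u * g⁻¹)⁻¹
      group⟩

theorem conj_le_iff (g : G) (S T : Sec G) :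
    S.conj g ≤ T ↔ (∀ l ∈ T.bot, g⁻¹ * l * g ∈ S.bot) ∧ (∀ u ∈ S.top, g * u * g⁻¹ ∈ T.top) := by
  refine and_congr ⟨fun h l hl => ?_, fun h l hl => ?_⟩ ⟨fun h u hu => ?_, ?_⟩
  · obtain ⟨v, hv, rfl⟩ := h hl
    simpa [mul_assoc] using hv
  · exact ⟨g⁻¹ * l * g, h l hl, by simp [mul_assoc]⟩
  · exact h ⟨u, hu, rfl⟩
  · rintro h _ ⟨u, hu, rfl⟩
    exact h u hu

/-- The section `(G, 1)`. -/
def whole (G : Type u) [Group G] : Sec G where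
  top := ⊤
  bot := ⊥
  bot_le_top := bot_le
  normal := by rw [Subgroup.bot_subgroupOf]; infer_instance

theorem le_whole (S : Sec G) : S ≤ whole G := ⟨bot_le, le_top⟩

/-- The subquotient `U / V`. -/
abbrev Quot (S : Sec G) : Type u := S.top ⧸ S.bot.subgroupOf S.top

end Sec

/-- A set of sections is a collection if it is closed under conjugation. -/
def IsCollection {G : Type u} [Group G] (C : Set (Sec G)) : Prop :=
  ∀ S ∈ C, ∀ g : G, S.conj g ∈ C

/-! ### The orbit category of sections -/

/-- The objects of the orbit category of sections `𝒟_G`: all sections of `G`. -/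
structure OrbitSec (G : Type u) [Group G] where
  sec : Sec G

namespace OrbitSec

variable {G : Type u} [Group G]

/-- A morphism `(U, V) ⟶ (M, L)` is a right coset `Mg` with `ᵍ(U, V) ≼ (M, L)`. -/
@[ext]
structure Hom (S T : OrbitSec G) where
  coset : Set G
  exists_rep : ∃ g : G, S.sec.conj g ≤ T.sec ∧ coset = MulOpposite.op g • (T.sec.top : Set G)

namespace Hom

variable {S T Q : OrbitSec G}

theorem mem_coset_op {M : Subgroup G} {g x : G} :
    x ∈ MulOpposite.op g • (M : Set G) ↔ x * g⁻¹ ∈ M := by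
  rw [mem_rightCoset_iff]; rfl

theorem nonempty (f : Hom S T) : f.coset.Nonempty := by
  obtain ⟨g, -, h⟩ := f.exists_rep
  exact ⟨g, by rw [h, mem_coset_op]; simp⟩

theorem conj_le (f : Hom S T) {x : G} (hx : x ∈ f.coset) : S.sec.conj x ≤ T.sec := by
  obtain ⟨g, hg, h⟩ := f.exists_rep
  rw [h, mem_coset_op] at hx
  rw [Sec.conj_le_iff] at hg ⊢
  refine ⟨fun l hl => ?_, fun u hu => ?_⟩
  · have := hg.1 _ (T.sec.conj_mem_bot (T.sec.top.inv_mem hx) hl)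
    convert this using 1; group
  · have := T.sec.top.mul_mem (T.sec.top.mul_mem hx (hg.2 u hu)) (T.sec.top.inv_mem hx)
    convert this using 1; group

theorem coset_eq (f : Hom S T) {x : G} (hx : x ∈ f.coset) :
    f.coset = MulOpposite.op x • (T.sec.top : Set G) := by
  obtain ⟨g, -, h⟩ := f.exists_rep
  rw [h, mem_coset_op] at hx
  rw [h, rightCoset_eq_iff]
  exact hx

/-- `Nh ∘ Mg = Nhg`, computed as a product of subsets of `G`. -/
theorem comp_rep (f : Hom S T) (k : Hom T Q) {g h : G} (hg : g ∈ f.coset) (hh : h ∈ k.coset) :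
    k.coset * f.coset = MulOpposite.op (h * g) • (Q.sec.top : Set G) := by
  ext x
  rw [f.coset_eq hg, k.coset_eq hh, mem_coset_op, Set.mem_mul]
  constructor
  · rintro ⟨y, hy, z, hz, rfl⟩
    rw [mem_coset_op] at hy hz
    have := Q.sec.top.mul_mem hy (((Sec.conj_le_iff _ _ _).1 (k.conj_le hh)).2 _ hz)
    convert this using 1; group
  · intro hx
    refine ⟨x * g⁻¹, ?_, g, ?_, by group⟩
    · rw [mem_coset_op]; convert hx using 1; group
    · rw [mem_coset_op]; simp

/-- The identity morphism `U1` of `(U, V)`. -/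
def id (S : OrbitSec G) : Hom S S := ⟨S.sec.top, 1, by simp [Sec.conj_le_iff], by simp⟩

/-- The composition `Nh ∘ Mg = Nhg`, as a product of subsets of `G`. -/
def comp (f : Hom S T) (k : Hom T Q) : Hom S Q := ⟨k.coset * f.coset, by
  obtain ⟨g, hg⟩ := f.nonempty
  obtain ⟨h, hh⟩ := k.nonempty
  refine ⟨h * g, ?_, Hom.comp_rep f k hg hh⟩
  have h1 := (Sec.conj_le_iff _ _ _).1 (f.conj_le hg)
  have h2 := (Sec.conj_le_iff _ _ _).1 (k.conj_le hh)
  rw [Sec.conj_le_iff]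
  refine ⟨fun l hl => ?_, fun u hu => ?_⟩
  · convert h1.1 _ (h2.1 l hl) using 1; group
  · convert h2.2 _ (h1.2 u hu) using 1; group⟩

end Hom

instance : SmallCategory (OrbitSec G) where
  Hom S T := Hom S T
  id S := Hom.id S
  comp f k := Hom.comp f k
  id_comp {S T} f := by
    obtain ⟨g, hg⟩ := f.nonempty
    apply Hom.ext
    refine (Hom.comp_rep (Hom.id S) f (S.sec.top.one_mem) hg).trans ?_
    rw [mul_one, f.coset_eq hg]
  comp_id {S T} f := by
    obtain ⟨g, hg⟩ := f.nonempty
    apply Hom.ext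
    refine (Hom.comp_rep f (Hom.id T) hg (T.sec.top.one_mem)).trans ?_
    rw [one_mul, f.coset_eq hg]
  assoc f g h := Hom.ext (mul_assoc _ _ _).symm

/-- The unique morphism `(U, V) ⟶ (G, 1)`, the coset `G1`. -/
def toWhole (S : OrbitSec G) : S ⟶ ⟨Sec.whole G⟩ :=
  (⟨Set.univ, 1, by simp [Sec.conj_le_iff, Sec.whole], by simp [Sec.whole]⟩ : Hom S ⟨Sec.whole G⟩)

theorem hom_whole_eq {S : OrbitSec G} (f k : S ⟶ ⟨Sec.whole G⟩) : f = k := by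
  have key : ∀ f : Hom S ⟨Sec.whole G⟩, f.coset = Set.univ := by
    rintro ⟨_, g, -, rfl⟩
    ext x
    simp [Sec.whole]
  exact Hom.ext ((key f).trans (key k).symm)

end OrbitSec

/-- `𝒟_G^𝒞`: the full subcategory of `𝒟_G` on the sections in `C`. -/
abbrev OrbitCat {G : Type u} [Group G] (C : Set (Sec G)) : Type u :=
  ObjectProperty.FullSubcategory (fun S : OrbitSec G => S.sec ∈ C)

/-- The inclusion of `𝒟_G^𝒞` in `𝒟_G`. -/
abbrev OrbitCat.incl {G : Type u} [Group G] (C : Set (Sec G)) : OrbitCat C ⥤ OrbitSec G :=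
  ObjectProperty.ι _

/-- The functor `i_* : 𝒟_G^𝒞' ⥤ 𝒟_G^𝒞` induced by an inclusion of collections. -/
abbrev OrbitCat.map {G : Type u} [Group G] {C' C : Set (Sec G)} (h : C' ⊆ C) :
    OrbitCat C' ⥤ OrbitCat C :=
  ObjectProperty.ιOfLE (fun _ hS => h hS)

/-! ### Modules over a small category and its cohomology -/

/-- Right `RD`-modules: contravariant functors from `D` to `R`-modules. -/
abbrev RMod (R : Type u) [CommRing R] (D : Type u) [SmallCategory D] : Type (u + 1) :=
  Dᵒᵖ ⥤ ModuleCat.{u} R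

/-- The constant functor `R` with identity maps. -/
abbrev constMod (R : Type u) [CommRing R] (D : Type u) [SmallCategory D] : RMod R D :=
  (Functor.const Dᵒᵖ).obj (ModuleCat.of R R)

instance RMod.enoughProjectives (R : Type u) [CommRing R] (D : Type u) [SmallCategory D] :
    EnoughProjectives (RMod R D) where
  presentation F := by
    let P : Dᵒᵖ → RMod R D := fun U =>
      (evaluationLeftAdjoint (ModuleCat.{u} R) U).obj (Projective.over (F.obj U))
    have hP : ∀ U, Projective (P U) := fun U =>
      (evaluationAdjunctionRight (ModuleCat.{u} R) U).map_projective _ inferInstance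
    let q : ∀ U, P U ⟶ F := fun U =>
      ((evaluationAdjunctionRight (ModuleCat.{u} R) U).homEquiv _ _).symm (Projective.π (F.obj U))
    suffices h : ∀ U, Epi ((Sigma.desc q).app U) from
      ⟨{ p := ∐ P, f := Sigma.desc q, epi := @NatTrans.epi_of_epi_app _ _ _ _ _ _ (Sigma.desc q) h }⟩
    intro U
    have h : (evaluationAdjunctionRight (ModuleCat.{u} R) U).unit.app _ ≫ (q U).app U
        = Projective.π (F.obj U) := by
      have := (evaluationAdjunctionRight (ModuleCat.{u} R) U).homEquiv_unit (f := q U)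
      rw [Equiv.apply_symm_apply] at this
      exact this.symm
    have h2 : q U = Sigma.ι P U ≫ Sigma.desc q := by simp
    rw [h2, NatTrans.comp_app, ← Category.assoc] at h
    exact epi_of_epi_fac h

instance RMod.hasExt (R : Type u) [CommRing R] (D : Type u) [SmallCategory D] :
    HasExt.{u} (RMod R D) :=
  hasExt_of_enoughProjectives _

/-- `Hⁿ(D; F) = Extⁿ_{RD}(R, F)`. -/
def cohomology {R : Type u} [CommRing R] {D : Type u} [SmallCategory D] (F : RMod R D) (n : ℕ) :
    ModuleCat.{u} R :=
  ModuleCat.of R (Abelian.Ext (constMod R D) F n)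

/-! ### The gluing problem and reduced cohomology -/

section Gluing

variable {G : Type u} [Group G] {R : Type u} [CommRing R]

/-- The restriction of an `R𝒟_G`-module to `𝒟_G^𝒞`. -/
abbrev RMod.restrict (C : Set (Sec G)) (F : RMod R (OrbitSec G)) : RMod R (OrbitCat C) :=
  (OrbitCat.incl C).op ⋙ F

/-- The maps `F(G) ⟶ F(U/V)` given by `Defres`, for `(U, V)` in `C`. -/
def defresCone (C : Set (Sec G)) (F : RMod R (OrbitSec G)) : Cone (F.restrict C) where
  pt := F.obj (Opposite.op ⟨Sec.whole G⟩)
  π :=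
    { app := fun S => F.map (OrbitSec.toWhole S.unop.obj).op
      naturality := fun S T f => by
        dsimp
        rw [Category.id_comp, ← F.map_comp, ← op_comp]
        exact congrArg (fun k => F.map (Quiver.Hom.op k)) (OrbitSec.hom_whole_eq _ _) }

/-- The detection map `r_G^F : F(G) ⟶ lim_{(U,V) ∈ 𝒟_G^𝒞} F(U/V)`. -/
def detectionMap (C : Set (Sec G)) (F : RMod R (OrbitSec G)) :
    F.obj (Opposite.op ⟨Sec.whole G⟩) ⟶ limit (F.restrict C) :=
  limit.lift (F.restrict C) (defresCone C F)

/-- The reduced cohomology `H̃ⁿ(𝒟_G^𝒞; F)`: the kernel and the cokernel of the detection map for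
`n = -1` and `n = 0`, the cohomology of `𝒟_G^𝒞` for `n ≥ 1`, and zero for `n < -1`. -/
def reducedCohomology (C : Set (Sec G)) (F : RMod R (OrbitSec G)) : ℤ → ModuleCat.{u} R
  | .negSucc 0 => kernel (detectionMap C F)
  | .negSucc (_ + 1) => ModuleCat.of R PUnit
  | .ofNat 0 => cokernel (detectionMap C F)
  | .ofNat (n + 1) => cohomology (F.restrict C) (n + 1)

end Gluing

/-! ### Realization of posets -/

/-- The topological realization of a finite poset `P`, that is, of the simplicial complex of its
chains, in barycentric coordinates: the points of the standard simplex on `P` supported on a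
chain, with the topology induced by `P → ℝ`. -/
def posetRealization (P : Type*) [PartialOrder P] [Finite P] : Set (P → ℝ) :=
  {x | (∀ p, 0 ≤ x p) ∧ ∑ᶠ p, x p = 1 ∧ IsChain (· ≤ ·) {p | x p ≠ 0}}

instance {G : Type u} [Group G] [Finite G] : Finite (Sec G) :=
  Finite.of_injective (fun S : Sec G => (S.top, S.bot))
    (fun _ _ h => Sec.ext (Prod.ext_iff.1 h).1 (Prod.ext_iff.1 h).2)

/-! ### Bisets and the Burnside group -/

/-- A finite `(K, H)`-biset: a finite set with commuting left `K`-action and right `H`-action. -/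
structure FinBiset (K H : Type u) [Group K] [Group H] where
  carrier : Type u
  finite : Finite carrier
  left : MulAction K carrier
  right : MulAction Hᵐᵒᵖ carrier
  comm : SMulCommClass K Hᵐᵒᵖ carrier

namespace FinBiset

attribute [instance] FinBiset.finite FinBiset.left FinBiset.right FinBiset.comm

instance {K H : Type u} [Group K] [Group H] : CoeSort (FinBiset K H) (Type u) := ⟨carrier⟩

variable {K H L N : Type u} [Group K] [Group H] [Group L] [Group N]

/-- The right action `x · h`. -/
abbrev rmul {X : FinBiset K H} (x : X) (h : H) : X := MulOpposite.op h • x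

theorem rmul_mul {X : FinBiset K H} (x : X) (h h' : H) : rmul (rmul x h) h' = rmul x (h * h') := by
  simp [rmul, smul_smul]

theorem rmul_one {X : FinBiset K H} (x : X) : rmul x (1 : H) = x := by simp [rmul]

theorem smul_rmul {X : FinBiset K H} (k : K) (x : X) (h : H) :
    k • rmul x h = rmul (k • x) h := smul_comm _ _ _

/-- Isomorphisms of bisets. -/
structure Iso (X Y : FinBiset K H) where
  toEquiv : X ≃ Y
  map_smul : ∀ (k : K) (x : X), toEquiv (k • x) = k • toEquiv x
  map_rmul : ∀ (x : X) (h : H), toEquiv (rmul x h) = rmul (toEquiv x) h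

instance isoSetoid (K H : Type u) [Group K] [Group H] : Setoid (FinBiset K H) where
  r X Y := Nonempty (Iso X Y)
  iseqv :=
    { refl := fun _ => ⟨⟨Equiv.refl _, fun _ _ => rfl, fun _ _ => rfl⟩⟩
      symm := fun ⟨e⟩ => ⟨⟨e.toEquiv.symm,
        fun k x => e.toEquiv.injective (by simp [e.map_smul]),
        fun x h => e.toEquiv.injective (by simp [e.map_rmul])⟩⟩
      trans := fun ⟨e⟩ ⟨f⟩ => ⟨⟨e.toEquiv.trans f.toEquiv,
        fun k x => by simp [e.map_smul, f.map_smul],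
        fun x h => by simp [e.map_rmul, f.map_rmul]⟩⟩ }

/-- The disjoint union of bisets. -/
def sum (X Y : FinBiset K H) : FinBiset K H where
  carrier := X ⊕ Y
  finite := inferInstance
  left := inferInstance
  right := inferInstance
  comm := ⟨by rintro k h (x | y) <;> simp [Sum.smul_inl, Sum.smul_inr, smul_comm k h]⟩

instance emptyAction (M : Type u) [Group M] : MulAction M PEmpty.{u + 1} where
  smul _ x := x
  one_smul _ := rfl
  mul_smul _ _ _ := rfl

/-- The empty biset. -/
def empty (K H : Type u) [Group K] [Group H] : FinBiset K H where
  carrier := PEmpty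
  finite := inferInstance
  left := emptyAction K
  right := emptyAction Hᵐᵒᵖ
  comm := ⟨fun _ _ x => x.elim⟩

/-- The identity biset `H`, with the actions by multiplication. -/
def one (H : Type u) [Group H] [Finite H] : FinBiset H H where
  carrier := H
  finite := inferInstance
  left := inferInstance
  right := inferInstance
  comm := inferInstance

/-- `(x, y)` and `(x h⁻¹, h y)` are identified in `X ×_H Y`. -/
def tensorSetoid (X : FinBiset K H) (Y : FinBiset H L) : Setoid (X × Y) where
  r p q := ∃ h : H, q = (rmul p.1 h⁻¹, h • p.2)
  iseqv :=
    { refl := fun p => ⟨1, by simp [rmul]⟩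
      symm := by
        rintro p _ ⟨h, rfl⟩
        exact ⟨h⁻¹, by simp [rmul_mul, rmul_one]⟩
      trans := by
        rintro p _ _ ⟨h, rfl⟩ ⟨h', rfl⟩
        exact ⟨h' * h, by simp [rmul_mul, mul_smul]⟩ }

instance tensorLeft (X : FinBiset K H) (Y : FinBiset H L) :
    MulAction K (Quotient (tensorSetoid X Y)) where
  smul k := Quotient.map (fun p => (k • p.1, p.2)) (by
    rintro p _ ⟨h, rfl⟩
    exact ⟨h, by simp [smul_rmul]⟩)
  one_smul := by rintro ⟨p⟩; exact congrArg (Quotient.mk _) (by simp)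
  mul_smul := by rintro k k' ⟨p⟩; exact congrArg (Quotient.mk _) (by simp [mul_smul])

instance tensorRight (X : FinBiset K H) (Y : FinBiset H L) :
    MulAction Lᵐᵒᵖ (Quotient (tensorSetoid X Y)) where
  smul l := Quotient.map (fun p => (p.1, l • p.2)) (by
    rintro p _ ⟨h, rfl⟩
    exact ⟨h, by simp [smul_comm h l]⟩)
  one_smul := by rintro ⟨p⟩; exact congrArg (Quotient.mk _) (by simp)
  mul_smul := by rintro k k' ⟨p⟩; exact congrArg (Quotient.mk _) (by simp [mul_smul])

/-- The composition product `X ×_H Y = (X × Y)/H`. -/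
def tensor (X : FinBiset K H) (Y : FinBiset H L) : FinBiset K L where
  carrier := Quotient (tensorSetoid X Y)
  finite := inferInstance
  left := tensorLeft X Y
  right := tensorRight X Y
  comm := ⟨by rintro k l ⟨p⟩; rfl⟩

/-- The class of `(x, y)` in `X ×_H Y`. -/
def tmk {X : FinBiset K H} {Y : FinBiset H L} (x : X) (y : Y) : tensor X Y :=
  Quotient.mk (tensorSetoid X Y) (x, y)

theorem tmk_smul {X : FinBiset K H} {Y : FinBiset H L} (k : K) (x : X) (y : Y) :
    k • tmk x y = tmk (k • x) y := rfl

theorem tmk_rmul {X : FinBiset K H} {Y : FinBiset H L} (x : X) (y : Y) (l : L) :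
    rmul (tmk x y) l = tmk x (rmul y l) := rfl

theorem tmk_balanced {X : FinBiset K H} {Y : FinBiset H L} (x : X) (h : H) (y : Y) :
    tmk (rmul x h) y = tmk x (h • y) :=
  Quotient.sound ⟨h, by simp [rmul_mul, rmul_one]⟩

theorem tensor_ind {X : FinBiset K H} {Y : FinBiset H L} {p : tensor X Y → Prop}
    (h : ∀ x y, p (tmk x y)) (t : tensor X Y) : p t := by
  obtain ⟨x, y⟩ := t; exact h x y

/-- Balanced maps out of `X × Y` factor through `X ×_H Y`. -/
def tlift {X : FinBiset K H} {Y : FinBiset H L} {Z : Type*} (f : X → Y → Z)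
    (hf : ∀ x h y, f (rmul x h) y = f x (h • y)) (t : tensor X Y) : Z :=
  Quotient.lift (fun p : X × Y => f p.1 p.2) (by
    rintro p _ ⟨h, rfl⟩
    simp [← hf, rmul_mul, rmul_one]) t

theorem tlift_tmk {X : FinBiset K H} {Y : FinBiset H L} {Z : Type*} (f : X → Y → Z)
    (hf : ∀ x h y, f (rmul x h) y = f x (h • y)) (x : X) (y : Y) :
    tlift f hf (tmk x y) = f x y := rfl

theorem tensor_congr {X X' : FinBiset K H} {Y Y' : FinBiset H L} (hX : X ≈ X') (hY : Y ≈ Y') :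
    tensor X Y ≈ tensor X' Y' := by
  obtain ⟨e⟩ := hX
  obtain ⟨f⟩ := hY
  refine ⟨⟨⟨tlift (fun x y => tmk (e.toEquiv x) (f.toEquiv y)) ?_,
    tlift (fun x y => tmk (e.toEquiv.symm x) (f.toEquiv.symm y)) ?_, ?_, ?_⟩, ?_, ?_⟩⟩
  · intro x h y; rw [e.map_rmul, f.map_smul, tmk_balanced]
  · intro x h y
    have h1 : e.toEquiv.symm (rmul x h) = rmul (e.toEquiv.symm x) h :=
      e.toEquiv.injective (by simp [e.map_rmul])
    have h2 : f.toEquiv.symm (h • y) = h • f.toEquiv.symm y :=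
      f.toEquiv.injective (by simp [f.map_smul])
    rw [h1, h2, tmk_balanced]
  · refine tensor_ind fun x y => ?_
    simp [tlift_tmk]
  · refine tensor_ind fun x y => ?_
    simp [tlift_tmk]
  · intro k
    refine tensor_ind fun x y => ?_
    change tmk (e.toEquiv (k • x)) _ = tmk (k • e.toEquiv x) _
    rw [e.map_smul]
  · intro t l
    revert t
    refine tensor_ind fun x y => ?_
    change tmk _ (f.toEquiv (rmul y l)) = tmk _ (rmul (f.toEquiv y) l)
    rw [f.map_rmul]

theorem sum_congr {X X' Y Y' : FinBiset K H} (hX : X ≈ X') (hY : Y ≈ Y') :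
    sum X Y ≈ sum X' Y' := by
  obtain ⟨e⟩ := hX
  obtain ⟨f⟩ := hY
  refine ⟨⟨Equiv.sumCongr e.toEquiv f.toEquiv, ?_, ?_⟩⟩
  · rintro k (x | y)
    · exact congrArg Sum.inl (e.map_smul k x)
    · exact congrArg Sum.inr (f.map_smul k y)
  · rintro (x | y) h
    · exact congrArg Sum.inl (e.map_rmul x h)
    · exact congrArg Sum.inr (f.map_rmul y h)

theorem sum_comm (X Y : FinBiset K H) : sum X Y ≈ sum Y X :=
  ⟨⟨Equiv.sumComm _ _, by rintro k (x | y) <;> rfl, by rintro (x | y) h <;> rfl⟩⟩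

theorem sum_assoc (X Y Z : FinBiset K H) : sum (sum X Y) Z ≈ sum X (sum Y Z) :=
  ⟨⟨Equiv.sumAssoc _ _ _, by rintro k ((x | y) | z) <;> rfl, by rintro ((x | y) | z) h <;> rfl⟩⟩

theorem sum_empty (X : FinBiset K H) : sum X (empty K H) ≈ X :=
  ⟨⟨Equiv.sumEmpty X PEmpty, by rintro k (x | ⟨⟨⟩⟩); rfl, by rintro (x | ⟨⟨⟩⟩) h; rfl⟩⟩

theorem tensor_assoc (X : FinBiset K H) (Y : FinBiset H L) (Z : FinBiset L N) :
    tensor (tensor X Y) Z ≈ tensor X (tensor Y Z) := by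
  refine ⟨⟨⟨fun t => tlift (fun s z => tlift (Z := tensor X (tensor Y Z))
      (fun x y => tmk x (tmk y z)) ?_ s) ?_ t,
    fun t => tlift (fun x s => tlift (Z := tensor (tensor X Y) Z)
      (fun y z => tmk (tmk x y) z) ?_ s) ?_ t, ?_, ?_⟩, ?_, ?_⟩⟩
  · intro x h y; rw [tmk_balanced, tmk_smul]
  · intro s l z
    revert s
    refine tensor_ind fun x y => ?_
    simp only [tmk_rmul, tlift_tmk, tmk_balanced]
  · intro y l z; rw [← tmk_rmul, tmk_balanced]
  · intro x h s
    revert s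
    refine tensor_ind fun y z => ?_
    simp only [tmk_smul, tlift_tmk, tmk_balanced]
  · intro t
    revert t
    refine tensor_ind fun s z => ?_
    revert s
    exact tensor_ind fun x y => rfl
  · intro t
    revert t
    refine tensor_ind fun x s => ?_
    revert s
    exact tensor_ind fun y z => rfl
  · intro k
    refine tensor_ind fun s z => ?_
    revert s
    exact tensor_ind fun x y => rfl
  · intro t n
    revert t
    refine tensor_ind fun s z => ?_
    revert s
    exact tensor_ind fun x y => rfl

theorem one_tensor [Finite K] (X : FinBiset K H) : tensor (one K) X ≈ X := by
  refine ⟨⟨⟨tlift (X := one K) (Z := X) (fun k x => (show K from k) • x) ?_,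
    fun x => tmk (X := one K) (1 : K) x, ?_, ?_⟩, ?_, ?_⟩⟩
  · intro k k' x; exact mul_smul (show K from k) k' x
  · refine tensor_ind fun k x => ?_
    change tmk (X := one K) (1 : K) ((show K from k) • x) = tmk k x
    rw [← tmk_balanced (X := one K) (1 : K) (show K from k) x]
    congr 1
    exact one_mul (show K from k)
  · intro x; exact one_smul K x
  · intro k
    refine tensor_ind fun k' x => ?_
    exact mul_smul k (show K from k') x
  · intro t h
    revert t
    refine tensor_ind fun k x => ?_
    exact smul_rmul (show K from k) x h

theorem tensor_one [Finite H] (X : FinBiset K H) : tensor X (one H) ≈ X := by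
  refine ⟨⟨⟨tlift (Y := one H) (Z := X) (fun x h => rmul x (show H from h)) ?_,
    fun x => tmk (Y := one H) x (1 : H), ?_, ?_⟩, ?_, ?_⟩⟩
  · intro x h h'; exact rmul_mul x h (show H from h')
  · refine tensor_ind fun x h => ?_
    change tmk (Y := one H) (rmul x (show H from h)) (1 : H) = tmk x h
    rw [tmk_balanced (Y := one H) x (show H from h) (1 : H)]
    congr 1
    exact mul_one (show H from h)
  · intro x; exact rmul_one x
  · intro k
    refine tensor_ind fun x h => ?_
    exact (smul_rmul k x (show H from h)).symm
  · intro t h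
    revert t
    refine tensor_ind fun x h' => ?_
    exact (rmul_mul x (show H from h') h).symm

theorem sum_tensor (X X' : FinBiset K H) (Y : FinBiset H L) :
    tensor (sum X X') Y ≈ sum (tensor X Y) (tensor X' Y) := by
  refine ⟨⟨⟨tlift (Z := tensor X Y ⊕ tensor X' Y)
      (fun (s : X ⊕ X') y => s.elim (fun x => Sum.inl (tmk x y)) (fun x => Sum.inr (tmk x y))) ?_,
    fun (s : tensor X Y ⊕ tensor X' Y) => s.elim
      (tlift (fun x y => tmk (X := sum X X') (Sum.inl x : X ⊕ X') y) ?_)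
      (tlift (fun x y => tmk (X := sum X X') (Sum.inr x : X ⊕ X') y) ?_), ?_, ?_⟩, ?_, ?_⟩⟩
  · rintro (x | x) h y
    · exact congrArg Sum.inl (tmk_balanced x h y)
    · exact congrArg Sum.inr (tmk_balanced x h y)
  · intro x h y; exact tmk_balanced (X := sum X X') (Sum.inl x : X ⊕ X') h y
  · intro x h y; exact tmk_balanced (X := sum X X') (Sum.inr x : X ⊕ X') h y
  · refine tensor_ind ?_
    rintro (x | x) y <;> rfl
  · rintro (s | s)
    · revert s; exact tensor_ind fun x y => rfl
    · revert s; exact tensor_ind fun x y => rfl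
  · intro k
    refine tensor_ind ?_
    rintro (x | x) y <;> rfl
  · intro t l
    revert t
    refine tensor_ind ?_
    rintro (x | x) y <;> rfl

theorem tensor_sum (X : FinBiset K H) (Y Y' : FinBiset H L) :
    tensor X (sum Y Y') ≈ sum (tensor X Y) (tensor X Y') := by
  refine ⟨⟨⟨tlift (Z := tensor X Y ⊕ tensor X Y')
      (fun x (s : Y ⊕ Y') => s.elim (fun y => Sum.inl (tmk x y)) (fun y => Sum.inr (tmk x y))) ?_,
    fun (s : tensor X Y ⊕ tensor X Y') => s.elim
      (tlift (fun x y => tmk (Y := sum Y Y') x (Sum.inl y : Y ⊕ Y')) ?_)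
      (tlift (fun x y => tmk (Y := sum Y Y') x (Sum.inr y : Y ⊕ Y')) ?_), ?_, ?_⟩, ?_, ?_⟩⟩
  · rintro x h (y | y)
    · exact congrArg Sum.inl (tmk_balanced x h y)
    · exact congrArg Sum.inr (tmk_balanced x h y)
  · intro x h y; exact tmk_balanced (Y := sum Y Y') x h (Sum.inl y : Y ⊕ Y')
  · intro x h y; exact tmk_balanced (Y := sum Y Y') x h (Sum.inr y : Y ⊕ Y')
  · refine tensor_ind ?_
    rintro x (y | y) <;> rfl
  · rintro (s | s)
    · revert s; exact tensor_ind fun x y => rfl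
    · revert s; exact tensor_ind fun x y => rfl
  · intro k
    refine tensor_ind ?_
    rintro x (y | y) <;> rfl
  · intro t l
    revert t
    refine tensor_ind ?_
    rintro x (y | y) <;> rfl

theorem empty_of_isEmpty (X : FinBiset K H) (h : X → False) : X ≈ empty K H :=
  ⟨⟨⟨fun x => (h x).elim, fun x => x.elim, fun x => (h x).elim, fun x => x.elim⟩,
    fun _ x => (h x).elim, fun x _ => (h x).elim⟩⟩

theorem empty_tensor (Y : FinBiset H L) : tensor (empty K H) Y ≈ empty K L :=
  empty_of_isEmpty _ (tensor_ind (fun x _ => PEmpty.elim x))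

theorem tensor_empty (X : FinBiset K H) : tensor X (empty H L) ≈ empty K L :=
  empty_of_isEmpty _ (tensor_ind (fun _ y => PEmpty.elim y))

end FinBiset

/-- Isomorphism classes of finite `(K, H)`-bisets. -/
abbrev BisetClass (K H : Type u) [Group K] [Group H] : Type (u + 1) :=
  Quotient (FinBiset.isoSetoid K H)

namespace BisetClass

variable {K H L N : Type u} [Group K] [Group H] [Group L] [Group N]

instance : Zero (BisetClass K H) := ⟨Quotient.mk _ (FinBiset.empty K H)⟩

instance : Add (BisetClass K H) :=
  ⟨Quotient.map₂ FinBiset.sum fun _ _ h _ _ k => FinBiset.sum_congr h k⟩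

/-- Isomorphism classes of bisets form a commutative monoid under disjoint union. -/
instance : AddCommMonoid (BisetClass K H) where
  add_assoc := by rintro ⟨X⟩ ⟨Y⟩ ⟨Z⟩; exact Quotient.sound (FinBiset.sum_assoc X Y Z)
  add_comm := by rintro ⟨X⟩ ⟨Y⟩; exact Quotient.sound (FinBiset.sum_comm X Y)
  add_zero := by rintro ⟨X⟩; exact Quotient.sound (FinBiset.sum_empty X)
  zero_add := by
    rintro ⟨X⟩
    exact Quotient.sound (Setoid.trans (FinBiset.sum_comm _ X) (FinBiset.sum_empty X))
  nsmul := nsmulRec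

/-- The composition product on isomorphism classes, additive in both variables. -/
def comp : BisetClass K H →+ BisetClass H L →+ BisetClass K L where
  toFun x :=
    { toFun := fun y => Quotient.map₂ FinBiset.tensor
        (fun _ _ h _ _ k => FinBiset.tensor_congr h k) x y
      map_zero' := by
        obtain ⟨X⟩ := x; exact Quotient.sound (FinBiset.tensor_empty X)
      map_add' := by
        obtain ⟨X⟩ := x
        rintro ⟨Y⟩ ⟨Y'⟩
        exact Quotient.sound (FinBiset.tensor_sum X Y Y') }
  map_zero' := by
    ext ⟨Y⟩; exact Quotient.sound (FinBiset.empty_tensor Y)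
  map_add' := by
    rintro ⟨X⟩ ⟨X'⟩
    ext ⟨Y⟩; exact Quotient.sound (FinBiset.sum_tensor X X' Y)

theorem comp_assoc (x : BisetClass K H) (y : BisetClass H L) (z : BisetClass L N) :
    comp (comp x y) z = comp x (comp y z) := by
  obtain ⟨X⟩ := x; obtain ⟨Y⟩ := y; obtain ⟨Z⟩ := z
  exact Quotient.sound (FinBiset.tensor_assoc X Y Z)

end BisetClass

/-- The Burnside group `B(K, H)` of `(K, H)`-bisets. -/
abbrev Burnside (K H : Type u) [Group K] [Group H] : Type (u + 1) :=
  Algebra.GrothendieckAddGroup (BisetClass K H)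

namespace Burnside

variable {K H L N : Type u} [Group K] [Group H] [Group L] [Group N]

/-- The element of `B(K, H)` given by a biset. -/
def of (X : FinBiset K H) : Burnside K H :=
  Algebra.GrothendieckAddGroup.of (Quotient.mk _ X : BisetClass K H)

theorem lift_of {M A : Type*} [AddCommMonoid M] [AddCommGroup A] (f : M →+ A) (m : M) :
    Algebra.GrothendieckAddGroup.lift f (Algebra.GrothendieckAddGroup.of m) = f m :=
  DFunLike.congr_fun (Algebra.GrothendieckAddGroup.lift.symm_apply_apply f) m

theorem induction {M : Type*} [AddCommMonoid M] {p : Algebra.GrothendieckAddGroup M → Prop}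
    (of : ∀ m, p (Algebra.GrothendieckAddGroup.of m)) (sub : ∀ x y, p x → p y → p (x - y))
    (x : Algebra.GrothendieckAddGroup M) : p x := by
  induction x using AddLocalization.ind with
  | _ q =>
  obtain ⟨a, s⟩ := q
  have h := sub _ _ (of a) (of s)
  change p (AddLocalization.addMonoidOf ⊤ a - AddLocalization.addMonoidOf ⊤ (s : M)) at h
  rw [← AddLocalization.mk_zero_eq_addMonoidOf_mk, ← AddLocalization.mk_zero_eq_addMonoidOf_mk,
    Algebra.GrothendieckAddGroup.mk_sub_mk] at h
  simpa using h

/-- The composition with an isomorphism class of bisets on the left. -/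
def compLeft (x : BisetClass K H) : Burnside H L →+ Burnside K L :=
  Algebra.GrothendieckAddGroup.lift (Algebra.GrothendieckAddGroup.of.comp (BisetClass.comp x))

theorem compLeft_of (x : BisetClass K H) (y : BisetClass H L) :
    compLeft x (Algebra.GrothendieckAddGroup.of y) =
      Algebra.GrothendieckAddGroup.of (BisetClass.comp x y) := lift_of _ y

theorem compLeft_add (x x' : BisetClass K H) :
    compLeft (L := L) (x + x') = compLeft x + compLeft x' := by
  ext y
  induction y using induction with
  | sub y y' hy hy' => simp only [map_sub, hy, hy']
  | of y =>
    rw [AddMonoidHom.add_apply, compLeft_of, compLeft_of, compLeft_of, map_add,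
      AddMonoidHom.add_apply, map_add]

/-- The composition product `B(K, H) × B(H, L) → B(K, L)`, the biadditive extension of
`(X, Y) ↦ X ×_H Y`. -/
def comp : Burnside K H →+ Burnside H L →+ Burnside K L :=
  Algebra.GrothendieckAddGroup.lift (AddMonoidHom.mk' compLeft compLeft_add)

theorem comp_of (X : FinBiset K H) (Y : FinBiset H L) :
    comp (of X) (of Y) = of (FinBiset.tensor X Y) := by
  unfold comp of
  rw [lift_of]
  exact compLeft_of _ _

theorem comp_assoc (x : Burnside K H) (y : Burnside H L) (z : Burnside L N) :
    comp (comp x y) z = comp x (comp y z) := by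
  induction x using induction with
  | sub x x' hx hx' => simp only [map_sub, AddMonoidHom.sub_apply, hx, hx']
  | of x =>
  induction y using induction with
  | sub x x' hx hx' => simp only [map_sub, AddMonoidHom.sub_apply, hx, hx']
  | of y =>
  induction z using induction with
  | sub x x' hx hx' => simp only [map_sub, hx, hx']
  | of z =>
  obtain ⟨X⟩ := x; obtain ⟨Y⟩ := y; obtain ⟨Z⟩ := z
  change comp (comp (of X) (of Y)) (of Z) = comp (of X) (comp (of Y) (of Z))
  simp only [comp_of]
  exact congrArg Algebra.GrothendieckAddGroup.of (Quotient.sound (FinBiset.tensor_assoc X Y Z))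

theorem one_comp [Finite K] (x : Burnside K H) : comp (of (FinBiset.one K)) x = x := by
  induction x using induction with
  | sub x x' hx hx' => simp only [map_sub, hx, hx']
  | of x =>
  obtain ⟨X⟩ := x
  refine (comp_of _ X).trans ?_
  exact congrArg Algebra.GrothendieckAddGroup.of (Quotient.sound (FinBiset.one_tensor X))

theorem comp_one [Finite H] (x : Burnside K H) : comp x (of (FinBiset.one H)) = x := by
  induction x using induction with
  | sub x x' hx hx' => simp only [map_sub, AddMonoidHom.sub_apply, hx, hx']
  | of x =>
  obtain ⟨X⟩ := x
  refine (comp_of X _).trans ?_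
  exact congrArg Algebra.GrothendieckAddGroup.of (Quotient.sound (FinBiset.tensor_one X))

/-- The composition product as a bilinear map over the integers. -/
def compInt : Burnside K H →ₗ[ℤ] Burnside H L →ₗ[ℤ] Burnside K L :=
  LinearMap.mk₂ ℤ (fun x y => comp x y) (by simp) (by simp) (by simp) (by simp)

end Burnside

/-! ### The biset category of a group and biset functors -/

/-- The objects of the `R`-biset category `Rℬ_G`: the sections `(U, V)` of `G`, standing for the
groups `U/V`. -/
structure BisetCat (R : Type u) (G : Type u) [Group G] where
  sec : Sec G

namespace BisetCat

variable {R G : Type u} [CommRing R] [Group G]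

/-- The `R`-module `R ⊗ B(K, H)`. -/
abbrev RB (R K H : Type u) [CommRing R] [Group K] [Group H] : Type (u + 1) := R ⊗[ℤ] Burnside K H

/-- The `R`-bilinear extension of the composition product. -/
def comp {K H L : Type u} [Group K] [Group H] [Group L] :
    RB R K H →ₗ[ℤ] RB R H L →ₗ[ℤ] RB R K L :=
  TensorProduct.map₂ (LinearMap.mul ℤ R) Burnside.compInt

theorem comp_tmul {K H L : Type u} [Group K] [Group H] [Group L] (a b : R) (x : Burnside K H)
    (y : Burnside H L) :
    comp (a ⊗ₜ[ℤ] x) (b ⊗ₜ[ℤ] y) = (a * b) ⊗ₜ[ℤ] Burnside.comp x y := rfl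

theorem smul_comp_left {K H L : Type u} [Group K] [Group H] [Group L] (r : R)
    (x : RB R K H) (y : RB R H L) : comp (r • x) y = r • comp x y := by
  induction x using TensorProduct.induction_on with
  | zero => simp
  | add x x' h h' => simp only [smul_add, map_add, LinearMap.add_apply, h, h']
  | tmul a x =>
  induction y using TensorProduct.induction_on with
  | zero => simp
  | add x x' h h' => simp only [smul_add, map_add, h, h']
  | tmul b y => simp only [TensorProduct.smul_tmul', comp_tmul, smul_eq_mul, mul_assoc]

theorem smul_comp_right {K H L : Type u} [Group K] [Group H] [Group L] (r : R)
    (x : RB R K H) (y : RB R H L) : comp x (r • y) = r • comp x y := by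
  induction x using TensorProduct.induction_on with
  | zero => simp
  | add x x' h h' => simp only [smul_add, map_add, LinearMap.add_apply, h, h']
  | tmul a x =>
  induction y using TensorProduct.induction_on with
  | zero => simp
  | add x x' h h' => simp only [smul_add, map_add, h, h']
  | tmul b y => simp only [TensorProduct.smul_tmul', comp_tmul, smul_eq_mul, mul_left_comm]

theorem comp_assoc {K H L N : Type u} [Group K] [Group H] [Group L] [Group N]
    (x : RB R K H) (y : RB R H L) (z : RB R L N) : comp (comp x y) z = comp x (comp y z) := by
  induction x using TensorProduct.induction_on with
  | zero => simp
  | add x x' h h' => simp only [map_add, LinearMap.add_apply, h, h']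
  | tmul a x =>
  induction y using TensorProduct.induction_on with
  | zero => simp
  | add x x' h h' => simp only [map_add, LinearMap.add_apply, h, h']
  | tmul b y =>
  induction z using TensorProduct.induction_on with
  | zero => simp
  | add x x' h h' => simp only [map_add, h, h']
  | tmul c z => simp only [comp_tmul, mul_assoc, Burnside.comp_assoc]

/-- The identity `1 ⊗ id_H`. -/
def one (R H : Type u) [CommRing R] [Group H] [Finite H] : RB R H H :=
  1 ⊗ₜ[ℤ] Burnside.of (FinBiset.one H)

theorem one_comp {K H : Type u} [Group K] [Finite K] [Group H] (x : RB R K H) :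
    comp (one R K) x = x := by
  induction x using TensorProduct.induction_on with
  | zero => simp
  | add x x' h h' => simp only [map_add, h, h']
  | tmul a x => rw [one, comp_tmul, one_mul, Burnside.one_comp]

theorem comp_one {K H : Type u} [Group K] [Group H] [Finite H] (x : RB R K H) :
    comp x (one R H) = x := by
  induction x using TensorProduct.induction_on with
  | zero => simp
  | add x x' h h' => simp only [map_add, LinearMap.add_apply, h, h']
  | tmul a x => rw [one, comp_tmul, mul_one, Burnside.comp_one]

variable [Finite G]

/-- Morphisms from `H = M/L` to `K = U/V` are the elements of `R ⊗ B(K, H)`. -/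
instance : Category.{u + 1} (BisetCat R G) where
  Hom A B := RB R B.sec.Quot A.sec.Quot
  id A := one R A.sec.Quot
  comp f g := comp g f
  id_comp f := comp_one f
  comp_id f := one_comp f
  assoc f g h := (comp_assoc h g f).symm

instance (A B : BisetCat R G) : AddCommGroup (A ⟶ B) :=
  inferInstanceAs (AddCommGroup (RB R B.sec.Quot A.sec.Quot))

instance (A B : BisetCat R G) : Module R (A ⟶ B) :=
  inferInstanceAs (Module R (RB R B.sec.Quot A.sec.Quot))

instance : Preadditive (BisetCat R G) where
  homGroup _ _ := inferInstance
  add_comp _ _ _ f f' g := map_add (comp (R := R) g) f f'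
  comp_add _ _ _ f g g' := LinearMap.congr_fun (map_add (comp (R := R)) g g') f

instance : Linear R (BisetCat R G) where
  homModule _ _ := inferInstance
  smul_comp _ _ _ r f g := smul_comp_right r g f
  comp_smul _ _ _ f r g := smul_comp_left r g f

end BisetCat

/-- A biset functor for `G` over `R`: an `R`-linear functor from `Rℬ_G` to `R`-modules. -/
structure BisetFunctor (R G : Type u) [CommRing R] [Group G] [Finite G] where
  toFunctor : BisetCat R G ⥤ ModuleCat.{u} R
  additive : toFunctor.Additive
  linear : toFunctor.Linear R

/-! ### The destriction bisets -/

namespace OrbitSec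

variable {G : Type u} [Group G]

namespace Hom

variable {S T Q : OrbitSec G}

/-- The set `g⁻¹M` of the inverses of the elements of the coset `Mg`. -/
abbrev Inv (f : Hom S T) : Type u := {x : G // x⁻¹ ∈ f.coset}

theorem mul_mem_inv (f : Hom S T) (x : f.Inv) {u m : G} (hu : u ∈ S.sec.top)
    (hm : m ∈ T.sec.top) : (u * x.1 * m)⁻¹ ∈ f.coset := by
  have h := ((Sec.conj_le_iff _ _ _).1 (f.conj_le x.2)).2 _ (S.sec.top.inv_mem hu)
  refine (Set.ext_iff.1 (f.coset_eq x.2) _).2 (mem_coset_op.2 ?_)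
  have := T.sec.top.mul_mem (T.sec.top.inv_mem hm) h
  convert this using 1; group

theorem mem_bot (f : Hom S T) (x : f.Inv) {l : G} (hl : l ∈ T.sec.bot) :
    x.1 * l * x.1⁻¹ ∈ S.sec.bot := by
  have h := ((Sec.conj_le_iff _ _ _).1 (f.conj_le x.2)).1 _ hl
  simpa using h

theorem inv_mul_mem (f : Hom S T) (x y : f.Inv) : x.1⁻¹ * y.1 ∈ T.sec.top := by
  have := mem_coset_op.1 ((Set.ext_iff.1 (f.coset_eq y.2) _).1 x.2)
  rwa [inv_inv] at this

/-- The orbit relation of the left multiplication action of `V` on `g⁻¹M`. -/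
def desSetoid (f : Hom S T) : Setoid f.Inv where
  r x y := ∃ v ∈ S.sec.bot, y.1 = v * x.1
  iseqv :=
    { refl := fun x => ⟨1, S.sec.bot.one_mem, by simp⟩
      symm := by
        rintro x y ⟨v, hv, h⟩
        exact ⟨v⁻¹, S.sec.bot.inv_mem hv, by simp [h]⟩
      trans := by
        rintro x y z ⟨v, hv, h⟩ ⟨w, hw, k⟩
        exact ⟨w * v, S.sec.bot.mul_mem hw hv, by rw [k, h, mul_assoc]⟩ }

theorem rel_iff {S : Sec G} (u u' : S.top) :
    QuotientGroup.leftRel (S.bot.subgroupOf S.top) u u' ↔ u.1⁻¹ * u'.1 ∈ S.bot := by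
  rw [QuotientGroup.leftRel_apply, Subgroup.mem_subgroupOf]; rfl

instance desLeft (f : Hom S T) : MulAction S.sec.Quot (Quotient f.desSetoid) where
  smul := Quotient.map₂ (fun (u : S.sec.top) (x : f.Inv) =>
      ⟨u.1 * x.1, by simpa using f.mul_mem_inv x u.2 T.sec.top.one_mem⟩) (by
    rintro u u' h x x' ⟨v, hv, k⟩
    have h' : u.1⁻¹ * u'.1 ∈ S.sec.bot := (rel_iff u u').1 h
    refine ⟨u.1 * ((u.1⁻¹ * u'.1) * v) * u.1⁻¹,
      S.sec.conj_mem_bot u.2 (S.sec.bot.mul_mem h' hv), ?_⟩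
    simp only [k]; group)
  one_smul := by
    rintro ⟨x⟩
    exact congrArg (Quotient.mk _) (Subtype.ext (one_mul x.1))
  mul_smul := by
    rintro ⟨u⟩ ⟨u'⟩ ⟨x⟩
    exact congrArg (Quotient.mk _) (Subtype.ext (mul_assoc u.1 u'.1 x.1))

instance desRight (f : Hom S T) : MulAction T.sec.Quotᵐᵒᵖ (Quotient f.desSetoid) where
  smul m := Quotient.map₂ (fun (m : T.sec.top) (x : f.Inv) =>
      ⟨x.1 * m.1, by simpa using f.mul_mem_inv x S.sec.top.one_mem m.2⟩) (by
    rintro m m' h x x' ⟨v, hv, k⟩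
    have h' : m.1⁻¹ * m'.1 ∈ T.sec.bot := (rel_iff m m').1 h
    have h2 := f.mem_bot x (T.sec.conj_mem_bot m.2 h')
    refine ⟨v * (x.1 * (m.1 * (m.1⁻¹ * m'.1) * m.1⁻¹) * x.1⁻¹), S.sec.bot.mul_mem hv h2, ?_⟩
    simp only [k]; group) m.unop
  one_smul := by
    rintro ⟨x⟩
    exact congrArg (Quotient.mk _) (Subtype.ext (mul_one x.1))
  mul_smul := by
    rintro ⟨⟨m⟩⟩ ⟨⟨m'⟩⟩ ⟨x⟩
    exact congrArg (Quotient.mk _) (Subtype.ext (mul_assoc x.1 m'.1 m.1).symm)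

/-- The `(U/V, M/L)`-biset of a morphism `f = Mg : (U, V) ⟶ (M, L)`. It is the set `V\g⁻¹M` with
the actions by multiplication, that is, the biset `c^{g⁻¹} ∘ Des` which first restricts from `M/L`
to `ᵍU/L`, then deflates to `ᵍU/ᵍV`, and then transports along conjugation by `g⁻¹` to `U/V`. -/
def desBiset [Finite G] (f : Hom S T) : FinBiset S.sec.Quot T.sec.Quot where
  carrier := Quotient f.desSetoid
  finite := inferInstance
  left := f.desLeft
  right := f.desRight
  comm := ⟨by
    rintro ⟨u⟩ ⟨⟨m⟩⟩ ⟨x⟩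
    exact congrArg (Quotient.mk _) (Subtype.ext (mul_assoc u.1 x.1 m.1).symm)⟩

theorem desBiset_id [Finite G] (S : OrbitSec G) :
    desBiset (Hom.id S) ≈ FinBiset.one S.sec.Quot := by
  have hx : ∀ x : (Hom.id S).Inv, x.1 ∈ S.sec.top := fun x => by
    have := S.sec.top.inv_mem x.2
    rwa [inv_inv] at this
  have key : ∀ u v : G, v ∈ S.sec.bot → u ∈ S.sec.top → u⁻¹ * v * u ∈ S.sec.bot :=
    fun u v hv hu => by simpa using S.sec.conj_mem_bot (S.sec.top.inv_mem hu) hv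
  refine ⟨⟨⟨Quotient.map (fun x => ⟨x.1, hx x⟩) ?_,
    Quotient.map (fun u => ⟨u.1, S.sec.top.inv_mem u.2⟩) ?_, ?_, ?_⟩, ?_, ?_⟩⟩
  · rintro x y ⟨v, hv, h⟩
    refine (rel_iff _ _).2 ?_
    change x.1⁻¹ * y.1 ∈ S.sec.bot
    rw [h, ← mul_assoc]
    exact key _ _ hv (hx x)
  · intro u u' h
    have h' : u.1⁻¹ * u'.1 ∈ S.sec.bot := (rel_iff u u').1 h
    refine ⟨_, S.sec.conj_mem_bot u.2 h', ?_⟩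
    simp
  · rintro ⟨x⟩; rfl
  · rintro ⟨x⟩; rfl
  · rintro ⟨u⟩ ⟨x⟩; rfl
  · rintro ⟨x⟩ ⟨u⟩; rfl

theorem desBiset_comp [Finite G] (f : Hom S T) (k : Hom T Q) :
    desBiset (Hom.comp f k) ≈ FinBiset.tensor (desBiset f) (desBiset k) := by
  symm
  have hmem : ∀ (x : f.Inv) (y : k.Inv), (x.1 * y.1)⁻¹ ∈ (Hom.comp f k).coset := fun x y => by
    rw [mul_inv_rev]; exact Set.mul_mem_mul y.2 x.2
  let φ : FinBiset.tensor (desBiset f) (desBiset k) → desBiset (Hom.comp f k) :=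
    FinBiset.tlift (X := desBiset f) (Y := desBiset k) (Quotient.map₂
      (fun (x : f.Inv) (y : k.Inv) => (⟨x.1 * y.1, hmem x y⟩ : (Hom.comp f k).Inv)) (by
        rintro x x' ⟨v, hv, h⟩ y y' ⟨l, hl, h'⟩
        refine ⟨v * (x.1 * l * x.1⁻¹), S.sec.bot.mul_mem hv (f.mem_bot x hl), ?_⟩
        simp only [h, h']; group)) (by
        rintro ⟨x⟩ ⟨m⟩ ⟨y⟩
        exact congrArg (Quotient.mk _) (Subtype.ext (mul_assoc x.1 m.1 y.1)))
  have hφ : Function.Bijective φ := by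
    constructor
    · refine FinBiset.tensor_ind ?_
      rintro ⟨x⟩ ⟨y⟩
      refine FinBiset.tensor_ind ?_
      rintro ⟨x'⟩ ⟨y'⟩ h
      obtain ⟨v, hv, h⟩ := Quotient.exact h
      have h : x'.1 * y'.1 = v * (x.1 * y.1) := h
      have hm : x.1⁻¹ * v⁻¹ * x'.1 ∈ T.sec.top := by
        have := f.inv_mul_mem ⟨v * x.1 * 1, f.mul_mem_inv x (S.sec.bot_le_top hv)
          T.sec.top.one_mem⟩ x'
        simpa using this
      let m' : T.sec.Quot := Quotient.mk _ ⟨x.1⁻¹ * v⁻¹ * x'.1, hm⟩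
      let X : desBiset f := Quotient.mk _ x
      let X' : desBiset f := Quotient.mk _ x'
      let Y : desBiset k := Quotient.mk _ y
      let Y' : desBiset k := Quotient.mk _ y'
      have h1 : FinBiset.rmul X m' = X' := by
        refine Quotient.sound ⟨v, hv, ?_⟩
        change x'.1 = v * (x.1 * (x.1⁻¹ * v⁻¹ * x'.1))
        group
      have h2 : m' • Y' = Y := by
        refine congrArg (Quotient.mk _) (Subtype.ext ?_)
        change x.1⁻¹ * v⁻¹ * x'.1 * y'.1 = y.1
        rw [mul_assoc, h]; group
      change FinBiset.tmk X Y = FinBiset.tmk X' Y'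
      rw [← h1, FinBiset.tmk_balanced, h2]
    · rintro ⟨z⟩
      obtain ⟨y, hy, x, hx, h⟩ := Set.mem_mul.1 z.2
      have h : y * x = z.1⁻¹ := h
      refine ⟨FinBiset.tmk (X := desBiset f) (Y := desBiset k)
        (Quotient.mk _ ⟨x⁻¹, by simpa using hx⟩) (Quotient.mk _ ⟨y⁻¹, by simpa using hy⟩), ?_⟩
      refine congrArg (Quotient.mk _) (Subtype.ext ?_)
      change x⁻¹ * y⁻¹ = z.1
      rw [← mul_inv_rev, h, inv_inv]
  refine ⟨⟨Equiv.ofBijective φ hφ, ?_, ?_⟩⟩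
  · rintro ⟨u⟩
    refine FinBiset.tensor_ind ?_
    rintro ⟨x⟩ ⟨y⟩
    exact congrArg (Quotient.mk _) (Subtype.ext (mul_assoc u.1 x.1 y.1))
  · intro t l
    revert t
    refine FinBiset.tensor_ind ?_
    obtain ⟨l⟩ := l
    rintro ⟨x⟩ ⟨y⟩
    exact congrArg (Quotient.mk _) (Subtype.ext (mul_assoc x.1 y.1 l.1).symm)

end Hom

end OrbitSec

/-- The functor `𝒟_Gᵒᵖ ⥤ Rℬ_G` sending a morphism to its destriction biset. -/
def desFunctor (R G : Type u) [CommRing R] [Group G] [Finite G] :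
    (OrbitSec G)ᵒᵖ ⥤ BisetCat R G where
  obj S := ⟨S.unop.sec⟩
  map {T S} f := (1 : R) ⊗ₜ[ℤ] Burnside.of (OrbitSec.Hom.desBiset f.unop)
  map_id S := congrArg (fun x => (1 : R) ⊗ₜ[ℤ] x) (congrArg Algebra.GrothendieckAddGroup.of
    (Quotient.sound (OrbitSec.Hom.desBiset_id S.unop)))
  map_comp {T S Q} f g := by
    refine (congrArg (fun x => (1 : R) ⊗ₜ[ℤ] x) (congrArg Algebra.GrothendieckAddGroup.of
      (Quotient.sound (OrbitSec.Hom.desBiset_comp g.unop f.unop)))).trans ?_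
    refine Eq.trans ?_ (BisetCat.comp_tmul (1 : R) 1 _ _).symm
    rw [one_mul, Burnside.comp_of]
    rfl

/-- The `R𝒟_G`-module associated to a biset functor. -/
def BisetFunctor.toRMod {R G : Type u} [CommRing R] [Group G] [Finite G] (F : BisetFunctor R G) :
    RMod R (OrbitSec G) :=
  desFunctor R G ⋙ F.toFunctor

/-- The obstruction group of the gluing problem for `F` over the collection `C`: the cokernel of
the detection map `r_G^F : F(G) ⟶ lim_{(U,V) ∈ 𝒟_G^𝒞} F(U/V)`. -/
def BisetFunctor.obs {R G : Type u} [CommRing R] [Group G] [Finite G] (C : Set (Sec G))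
    (F : BisetFunctor R G) : ModuleCat.{u} R :=
  cokernel (detectionMap C F.toRMod)

end

/-! ### Ordered chains on lists of vertices -/

/-! Restriction along `i_*` is exact. It therefore suffices to resolve the constant module over the
larger category by projectives that restrict to projectives, and such that restriction is bijective
on morphisms from them to any module. Dimension shifting (`mapExt_bijective_of_resolution`) then
shows that restriction is bijective on all extension groups.

The resolution is built from the arrows from an object `w` to the sections of the smaller
collection, preordered by factorization: a chain at `w` is a combination of lists of pairwise
comparable arrows. Every morphism of the orbit category is an epimorphism, so precomposition
preserves and reflects factorization. A nonempty list of comparable arrows has a least entry `f`,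
through which the others factor uniquely, and choosing the first least entry is natural in `w`
(`normalize_map_pull`). The chains thus behave like a sum of representable modules at objects of the
subcategory. This gives both projectivity statements (`projective_restricted_chains`) and the
bijection on morphisms (`whiskerLeft_chains_bijective`).

Exactness is where contractibility enters. Sending an arrow with representative `g` and target `T`
to the section `g⁻¹Tg` is an equivalence from the preorder of arrows to the poset of sections above
`w`; contiguous maps are chain homotopic, so only the complex of this finite poset matters
(`IsAcyclic.of_contiguous`). Its exactness is `isAcyclic_of_contractibleSpace`, proved by simplicial
approximation: a cycle is finely subdivided and moved along the contraction in small time steps,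
each point being rounded to a vertex at which its coordinate is large. Successive roundings are
contiguous, the first is homotopic to the identity and the last is constant, so the cycle bounds.

In degree zero, morphisms out of the constant module are the elements of the limit. The two limits
are thus isomorphic, compatibly with the detection maps, so the kernels and cokernels agree; the
obstruction group is one of these cokernels. -/

namespace ListChain

section Algebra

variable {R : Type*} [CommRing R] {V W : Type*}

/-- A linear map sends chains supported in `A` to `N` if it does so for the lists in `A`. -/
theorem map_mem_of_mem_supported {M : Type*} [AddCommGroup M] [Module R M]
    (L : (List V →₀ R) →ₗ[R] M) {A : Set (List V)} {N : Submodule R M}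
    (h : ∀ l ∈ A, L (Finsupp.single l 1) ∈ N) {z : List V →₀ R}
    (hz : z ∈ Finsupp.supported R R A) : L z ∈ N := by
  rw [Finsupp.supported_eq_span_single] at hz
  have : Submodule.span R ((fun i => Finsupp.single i (1 : R)) '' A) ≤ N.comap L :=
    Submodule.span_le.2 (by rintro _ ⟨l, hl, rfl⟩; exact h l hl)
  exact this hz

/-- Prepending a vertex. -/
noncomputable def cone (v : V) : (List V →₀ R) →ₗ[R] (List V →₀ R) :=
  Finsupp.lmapDomain R R (List.cons v)

@[simp]
theorem cone_single (v : V) (l : List V) (a : R) :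
    cone v (Finsupp.single l a) = Finsupp.single (v :: l) a :=
  Finsupp.mapDomain_single

theorem cone_mem {v : V} {A B : Set (List V)} (h : ∀ l ∈ A, v :: l ∈ B) {z : List V →₀ R}
    (hz : z ∈ Finsupp.supported R R A) : cone v z ∈ Finsupp.supported R R B :=
  map_mem_of_mem_supported _ (fun l hl => by
    rw [cone_single]; exact Finsupp.single_mem_supported _ _ (h l hl)) hz

/-- The boundary of a list, with `∂ (v :: l) = l - v :: ∂ l`. -/
noncomputable def bdList (R : Type*) [CommRing R] {V : Type*} : List V → (List V →₀ R)
  | [] => 0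
  | v :: l => Finsupp.single l 1 - cone v (bdList R l)

/-- The boundary operator of the augmented ordered chain complex. -/
noncomputable def bd : (List V →₀ R) →ₗ[R] (List V →₀ R) :=
  Finsupp.linearCombination R (bdList R)

@[simp]
theorem bd_single (l : List V) : bd (Finsupp.single l (1 : R)) = bdList R l := by
  simp [bd]

/-- The augmentation makes this hold without exception, since `[v]` has boundary `[]`. Hence `cone
v` contracts every complex of lists that is closed under prepending `v`. -/
theorem bd_cone (v : V) (z : List V →₀ R) : bd (cone v z) = z - cone v (bd z) := by
  have : bd ∘ₗ cone v = LinearMap.id - cone v ∘ₗ bd (R := R) := by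
    ext l : 2
    simp [bdList]
  exact LinearMap.congr_fun this z

theorem bd_bd (z : List V →₀ R) : bd (bd z) = 0 := by
  have : bd ∘ₗ bd = (0 : (List V →₀ R) →ₗ[R] (List V →₀ R)) := by
    ext l : 2
    induction l with
    | nil => simp [bdList]
    | cons v l ih =>
      simp only [LinearMap.comp_apply, Finsupp.lsingle_apply, bd_single, LinearMap.zero_apply] at ih
      simp [bdList, bd_cone, ih]
  exact LinearMap.congr_fun this z

theorem bdList_mem (l : List V) :
    bdList R l ∈ Finsupp.supported R R {m | m.Sublist l ∧ m.length + 1 = l.length} := by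
  induction l with
  | nil => exact Submodule.zero_mem _
  | cons v l ih =>
    refine Submodule.sub_mem _ (Finsupp.single_mem_supported _ _ ⟨List.sublist_cons_self _ _, rfl⟩)
      
      (cone_mem (A := {m | m.Sublist l ∧ m.length + 1 = l.length})
        (B := {m | m.Sublist (v :: l) ∧ m.length + 1 = (v :: l).length})
        (fun m hm => ⟨hm.1.cons_cons v, by simp [hm.2]⟩) ih)

theorem bd_mem {A B : Set (List V)}
    (h : ∀ l ∈ A, ∀ m : List V, m.Sublist l → m.length + 1 = l.length → m ∈ B)
    {z : List V →₀ R} (hz : z ∈ Finsupp.supported R R A) : bd z ∈ Finsupp.supported R R B :=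
  map_mem_of_mem_supported _ (fun l hl => by
    rw [bd_single]
    exact Finsupp.supported_mono (fun m hm => h l hl m hm.1 hm.2) (bdList_mem l)) hz

/-- The chain map induced by a map of vertices. -/
noncomputable def push (f : V → W) : (List V →₀ R) →ₗ[R] (List W →₀ R) :=
  Finsupp.lmapDomain R R (List.map f)

@[simp]
theorem push_single (f : V → W) (l : List V) (a : R) :
    push f (Finsupp.single l a) = Finsupp.single (l.map f) a :=
  Finsupp.mapDomain_single

theorem push_cone (f : V → W) (v : V) (z : List V →₀ R) :
    push f (cone v z) = cone (f v) (push f z) := by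
  have : push f ∘ₗ cone v = cone (f v) ∘ₗ push (R := R) f := by ext l : 2; simp
  exact LinearMap.congr_fun this z

theorem bd_push (f : V → W) (z : List V →₀ R) : bd (push f z) = push f (bd z) := by
  have : bd ∘ₗ push f = push f ∘ₗ bd (R := R) := by
    ext l : 2
    induction l with
    | nil => simp [bdList]
    | cons v l ih => simp_all [bdList, push_cone]
  exact LinearMap.congr_fun this z

theorem push_mem {f : V → W} {A : Set (List V)} {B : Set (List W)} (h : ∀ l ∈ A, l.map f ∈ B)
    {z : List V →₀ R} (hz : z ∈ Finsupp.supported R R A) :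
    push f z ∈ Finsupp.supported R R B :=
  map_mem_of_mem_supported _ (fun l hl => by
    rw [push_single]; exact Finsupp.single_mem_supported _ _ (h l hl)) hz

theorem push_push {U : Type*} (f : V → W) (g : W → U) (z : List V →₀ R) :
    push g (push f z) = push (g ∘ f) z := by
  have : push g ∘ₗ push f = push (R := R) (g ∘ f) := by ext l : 2; simp
  exact LinearMap.congr_fun this z

theorem push_id (z : List V →₀ R) : push id z = z := by
  have : push id = LinearMap.id (R := R) (M := List V →₀ R) := by ext l : 2; simp
  exact LinearMap.congr_fun this z

/-- The prism over a list. -/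
noncomputable def prismList (R : Type*) [CommRing R] {V W : Type*} (f g : V → W) :
    List V → (List W →₀ R)
  | [] => 0
  | v :: l => Finsupp.single (f v :: g v :: l.map g) 1 - cone (f v) (prismList R f g l)

/-- The prism operator, a homotopy between two maps of vertices. -/
noncomputable def prism (f g : V → W) : (List V →₀ R) →ₗ[R] (List W →₀ R) :=
  Finsupp.linearCombination R (prismList R f g)

@[simp]
theorem prism_single (f g : V → W) (l : List V) :
    prism f g (Finsupp.single l (1 : R)) = prismList R f g l := by
  simp [prism]

theorem prism_cone (f g : V → W) (v : V) (z : List V →₀ R) :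
    prism f g (cone v z) = cone (f v) (cone (g v) (push g z)) - cone (f v) (prism f g z) := by
  have : prism f g ∘ₗ cone v =
      cone (f v) ∘ₗ cone (g v) ∘ₗ push g - cone (f v) ∘ₗ prism (R := R) f g := by
    ext l : 2
    simp [prismList]
  exact LinearMap.congr_fun this z

theorem bd_prism (f g : V → W) (z : List V →₀ R) :
    bd (prism f g z) = push g z - push f z - prism f g (bd z) := by
  have : bd ∘ₗ prism f g = push g - push f - prism f g ∘ₗ bd (R := R) := by
    ext l : 2
    induction l with
    | nil => simp [bdList, prismList]
    | cons v l ih =>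
      simp only [LinearMap.comp_apply, Finsupp.lsingle_apply, LinearMap.sub_apply, bd_single,
        push_single, prism_single] at ih ⊢
      -- Writing the leading term as an iterated cone lets `bd_cone` compute its boundary.
      have e : Finsupp.single (f v :: g v :: l.map g) (1 : R)
          = cone (f v) (cone (g v) (push g (Finsupp.single l 1))) := by simp
      simp only [prismList, bdList, map_sub, e, bd_cone, ih, prism_single, prism_cone, bd_push]
      simp
      abel
  exact LinearMap.congr_fun this z

theorem prism_mem {f g : V → W} {A : Set (List V)} {B : Set (List W)}
    (h : ∀ l ∈ A, ∀ m : List W, (∀ w ∈ m, ∃ v ∈ l, w = f v ∨ w = g v) → m ∈ B)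
    {z : List V →₀ R} (hz : z ∈ Finsupp.supported R R A) :
    prism f g z ∈ Finsupp.supported R R B := by
  refine map_mem_of_mem_supported _ (fun l hl => ?_) hz
  rw [prism_single]
  refine Finsupp.supported_mono (h l hl) ?_
  clear hl h
  induction l with
  | nil => exact Submodule.zero_mem _
  | cons v l ih =>
    refine Submodule.sub_mem _ (Finsupp.single_mem_supported _ _ ?_) (cone_mem ?_ ih)
    · intro w hw
      simp only [List.mem_cons, List.mem_map] at hw
      rcases hw with rfl | rfl | ⟨a, ha, rfl⟩
      · exact ⟨v, by simp⟩
      · exact ⟨v, by simp⟩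
      · exact ⟨a, by simp [ha]⟩
    · intro m hm w hw
      rcases List.mem_cons.1 hw with rfl | hw
      · exact ⟨v, by simp⟩
      · obtain ⟨a, ha, h⟩ := hm w hw
        exact ⟨a, by simp [ha], h⟩

/-- Linear operators on chains can be defined by recursion on the boundary. -/
theorem exists_operator (u : List W →₀ R) (step : List V → (List W →₀ R) → (List W →₀ R)) :
    ∃ L : (List V →₀ R) →ₗ[R] (List W →₀ R), L (Finsupp.single [] 1) = u ∧
      ∀ v l, L (Finsupp.single (v :: l) 1) = step (v :: l) (L (bdList R (v :: l))) := by
  -- `F n` is only meaningful on lists of length `n`. The operator uses the diagonal `F l.length l`,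
  -- and `key` identifies the two on chains of length `n`.
  let F : ℕ → List V → (List W →₀ R) := fun n => Nat.rec (fun _ => u)
    (fun _ f l => step l (Finsupp.linearCombination R f (bdList R l))) n
  refine ⟨Finsupp.linearCombination R fun l => F l.length l, by simp [F], fun v l => ?_⟩
  have key : ∀ n, ∀ z ∈ Finsupp.supported R R {m : List V | m.length = n},
      Finsupp.linearCombination R (F n) z = Finsupp.linearCombination R (fun l => F l.length l) z := by
    intro n z hz
    rw [← sub_eq_zero, ← LinearMap.sub_apply, ← Submodule.mem_bot R]
    refine map_mem_of_mem_supported _ (fun m hm => ?_) hz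
    have hm : m.length = n := hm
    simp [hm]
  rw [Finsupp.linearCombination_single, one_smul,
    ← key l.length _ (Finsupp.supported_mono (fun m hm => by simpa using hm.2) (bdList_mem _))]
  rfl

/-- An augmented chain map which carries each list to chains on its entries is homotopic to the
identity, through a homotopy with the same property. -/
theorem exists_homotopy_of_carried (Φ : (List V →₀ R) →ₗ[R] (List V →₀ R))
    (h_bd : ∀ z, bd (Φ z) = Φ (bd z)) (h_nil : Φ (Finsupp.single [] 1) = Finsupp.single [] 1)
    (hΦ : ∀ l, Φ (Finsupp.single l 1) ∈ Finsupp.supported R R {m | m ⊆ l}) :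
    ∃ T : (List V →₀ R) →ₗ[R] (List V →₀ R), (∀ z, bd (T z) = Φ z - z - T (bd z)) ∧
      ∀ l, T (Finsupp.single l 1) ∈ Finsupp.supported R R {m | m ⊆ l} := by
  -- Acyclic carrier argument: the lists with entries in `v :: l` are contracted by `cone v`. By
  -- induction the chain `Φ l - l - T (∂ l)` is a cycle, so coning it off solves the homotopy
  -- equation.
  obtain ⟨T, hT0, hT⟩ := exists_operator (R := R) (V := V) (W := V) 0 (fun l c =>
    match l with
    | [] => 0
    | v :: l => cone v (Φ (Finsupp.single (v :: l) 1) - Finsupp.single (v :: l) 1 - c))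
  simp only at hT
  have h1 : ∀ n, ∀ l : List V, l.length = n → bd (T (Finsupp.single l 1)) =
      Φ (Finsupp.single l 1) - Finsupp.single l 1 - T (bd (Finsupp.single l 1)) := by
    intro n
    induction n with
    | zero =>
      intro l hl
      rw [List.length_eq_zero_iff.1 hl, hT0, h_nil]
      simp [bdList]
    | succ n ih =>
      rintro (_ | ⟨v, l⟩) hl
      · simp at hl
      have h2 : bd (T (bdList R (v :: l))) =
          Φ (bdList R (v :: l)) - bdList R (v :: l) - T (bd (bdList R (v :: l))) := by
        have := map_mem_of_mem_supported (N := ⊥) (bd ∘ₗ T - (Φ - LinearMap.id - T ∘ₗ bd))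
          (A := {m : List V | m.length = n}) (fun m hm => by
            have := ih m hm
            simp only [LinearMap.sub_apply, LinearMap.comp_apply, LinearMap.id_apply,
              Submodule.mem_bot, this, sub_self])
          (Finsupp.supported_mono (fun m hm => by
            have := hm.2
            simp only [List.length_cons] at this hl
            exact (by omega : m.length = n)) (bdList_mem (R := R) (v :: l)))
        simpa [sub_eq_zero] using this
      have h3 : bd (bdList R (v :: l)) = 0 := by rw [← bd_single, bd_bd]
      simp only [hT, bd_cone, map_sub, h2, h3, h_bd, bd_single, map_zero]
      abel
  refine ⟨T, fun z => ?_, ?_⟩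
  · have : bd ∘ₗ T = Φ - LinearMap.id - T ∘ₗ bd := by
      ext l : 2
      exact h1 _ l rfl
    exact LinearMap.congr_fun this z
  · have h4 : ∀ n, ∀ l : List V, l.length = n →
        T (Finsupp.single l 1) ∈ Finsupp.supported R R {m | m ⊆ l} := by
      intro n
      induction n with
      | zero =>
        intro l hl
        rw [List.length_eq_zero_iff.1 hl, hT0]
        exact Submodule.zero_mem _
      | succ n ih =>
        rintro (_ | ⟨v, l⟩) hl
        · simp at hl
        rw [hT]
        refine cone_mem (A := {m | m ⊆ v :: l}) (fun m hm => ?_)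
          (Submodule.sub_mem _ (Submodule.sub_mem _ (hΦ _) ?_) ?_)
        · exact List.cons_subset.2 ⟨by simp, hm⟩
        · exact Finsupp.single_mem_supported _ _ (List.Subset.refl _)
        · refine map_mem_of_mem_supported T (fun m hm => ?_) (bdList_mem _)
          refine Finsupp.supported_mono (fun k hk => ?_) (ih m ?_)
          · exact List.Subset.trans hk hm.1.subset
          · have := hm.2
            simp only [List.length_cons] at this hl
            omega
    exact fun l => h4 _ l rfl

/-- The boundary is compatible with restriction to the lists of a given length. -/
theorem bd_filter_length (n : ℕ) (z : List V →₀ R) :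
    bd (z.filter fun l => l.length = n + 1) = (bd z).filter fun l => l.length = n := by
  induction z using Finsupp.induction_linear with
  | zero => rw [map_zero, Finsupp.filter_zero, Finsupp.filter_zero, map_zero]
  | add x y hx hy => rw [Finsupp.filter_add, map_add, hx, hy, map_add, Finsupp.filter_add]
  | single l a =>
    have e : Finsupp.single l a = a • Finsupp.single l (1 : R) := by simp
    have hl := bdList_mem (R := R) l
    rw [e, Finsupp.filter_smul, map_smul, map_smul, Finsupp.filter_smul, bd_single]
    by_cases h : l.length = n + 1
    · rw [Finsupp.filter_single_of_pos _ (by exact h), bd_single, (Finsupp.filter_eq_self_iff _ _).2]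
      intro m hm
      have := (hl (Finsupp.mem_support_iff.2 hm)).2
      omega
    · rw [Finsupp.filter_single_of_neg _ (by exact h), map_zero, (Finsupp.filter_eq_zero_iff _ _).2]
      intro m hm
      by_contra h0
      have := (hl (Finsupp.mem_support_iff.2 h0)).2
      omega

/-- The lists whose entries are pairwise related. -/
def cliques (r : V → V → Prop) : Set (List V) := {l | ∀ a ∈ l, ∀ b ∈ l, r a b}

theorem cliques_of_subset {r : V → V → Prop} {l m : List V} (hl : l ∈ cliques r) (h : m ⊆ l) :
    m ∈ cliques r :=
  fun a ha b hb => hl a (h ha) b (h hb)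

/-- The augmented chain complex of the lists of pairwise related vertices is exact. -/
def IsAcyclic (R : Type*) [CommRing R] {V : Type*} (r : V → V → Prop) : Prop :=
  ∀ z ∈ Finsupp.supported R R (cliques r), bd z = 0 →
    ∃ y ∈ Finsupp.supported R R (cliques r), bd y = z

end Algebra

end ListChain

namespace ListChain

/-! ### Barycentric subdivision of lists of points -/

section Subdivision

variable {R : Type*} [CommRing R] {E : Type*} [NormedAddCommGroup E] [NormedSpace ℝ E]

/-- The barycenter of a list of points. -/
noncomputable def bary (l : List E) : E := (l.length : ℝ)⁻¹ • l.sum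

/-- Adding a head to a tail of length `n` is a convex combination with weights `1 / (1 + n)` and `n
/ (1 + n)`. Keeping the sum undivided makes the induction direct. -/
theorem sum_mem_smul {T : Set E} (hT : Convex ℝ T) (v : E) (l : List E)
    (h : ∀ x ∈ v :: l, x ∈ T) : ∃ x ∈ T, (v :: l).sum = ((v :: l).length : ℝ) • x := by
  induction l generalizing v with
  | nil => exact ⟨v, h v (by simp), by simp⟩
  | cons w l ih =>
    obtain ⟨x, hx, e⟩ := ih w (fun x hx => h x (List.mem_cons_of_mem _ hx))
    have hp : (0 : ℝ) < (w :: l).length := by simp; positivity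
    refine ⟨(1 / (1 + ((w :: l).length : ℝ))) • v +
      (((w :: l).length : ℝ) / (1 + ((w :: l).length : ℝ))) • x,
      hT (h v (by simp)) hx (by positivity) (by positivity) (by field_simp), ?_⟩
    rw [List.sum_cons, e, List.length_cons (a := v), Nat.cast_add, Nat.cast_one, smul_add, smul_smul,
      smul_smul, add_comm ((w :: l).length : ℝ) 1, mul_one_div_cancel (by positivity),
      mul_div_cancel₀ _ (by positivity), one_smul]

theorem bary_mem {T : Set E} (hT : Convex ℝ T) (v : E) (l : List E) (h : ∀ x ∈ v :: l, x ∈ T) :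
    bary (v :: l) ∈ T := by
  obtain ⟨x, hx, e⟩ := sum_mem_smul hT v l h
  have : ((v :: l).length : ℝ) ≠ 0 := by simp; positivity
  rwa [bary, e, inv_smul_smul₀ this]

theorem norm_sum_sub_le (x : E) {d : ℝ} (l : List E) (h : ∀ y ∈ l, dist y x ≤ d) :
    ‖l.sum - (l.length : ℝ) • x‖ ≤ l.length * d := by
  induction l with
  | nil => simp
  | cons y l ih =>
    have h1 := ih (fun z hz => h z (List.mem_cons_of_mem _ hz))
    have h2 := h y (by simp)
    rw [dist_eq_norm] at h2
    have e : (y :: l).sum - ((y :: l).length : ℝ) • x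
        = (y - x) + (l.sum - (l.length : ℝ) • x) := by
      simp [add_smul]; abel
    rw [e]
    refine (norm_add_le _ _).trans ?_
    simp only [List.length_cons, Nat.cast_add, Nat.cast_one]
    linarith

/-- In the average of the differences `y - x` the occurrence of `x` itself contributes zero, so only
`n - 1` of the `n` terms count. This gap is what makes the mesh of iterated subdivisions shrink. -/
theorem dist_bary_le {l : List E} {d : ℝ} (h : ∀ x ∈ l, ∀ y ∈ l, dist x y ≤ d) {x : E}
    (hx : x ∈ l) : dist x (bary l) ≤ (1 - (l.length : ℝ)⁻¹) * d := by
  obtain ⟨s, t, rfl⟩ := List.append_of_mem hx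
  have h1 := norm_sum_sub_le x (s ++ t) (d := d)
    (fun y hy => h y (by simp at hy ⊢; tauto) x hx)
  have hn : ((s ++ x :: t).length : ℝ) = (s ++ t).length + 1 := by simp; ring
  have hp : (0 : ℝ) < (s ++ x :: t).length := by rw [hn]; positivity
  have e : bary (s ++ x :: t) - x =
      ((s ++ x :: t).length : ℝ)⁻¹ • ((s ++ t).sum - ((s ++ t).length : ℝ) • x) := by
    have h2 : (s ++ x :: t).sum - ((s ++ x :: t).length : ℝ) • x
        = (s ++ t).sum - ((s ++ t).length : ℝ) • x := by
      rw [hn, add_smul]; simp; abel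
    rw [← h2, smul_sub, inv_smul_smul₀ hp.ne', bary]
  rw [dist_comm, dist_eq_norm, e, norm_smul, norm_inv, Real.norm_natCast]
  calc _ ≤ ((s ++ x :: t).length : ℝ)⁻¹ * ((s ++ t).length * d) := by gcongr
    _ = _ := by rw [show ((s ++ t).length : ℝ) = (s ++ x :: t).length - 1 by rw [hn]; ring]
                field_simp

/-- The barycentric subdivision of chains of points of a normed space. -/
theorem exists_subdivision (R : Type*) [CommRing R] (E : Type*) [NormedAddCommGroup E]
    [NormedSpace ℝ E] : ∃ S : (List E →₀ R) →ₗ[R] (List E →₀ R),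
      S (Finsupp.single [] 1) = Finsupp.single [] 1 ∧ (∀ z, bd (S z) = S (bd z)) ∧
      (∀ T : Set E, Convex ℝ T → ∀ l : List E, (∀ x ∈ l, x ∈ T) →
        S (Finsupp.single l 1) ∈ Finsupp.supported R R {m | ∀ x ∈ m, x ∈ T}) ∧
      (∀ (n : ℕ) (d : ℝ), 0 ≤ d → ∀ l : List E, l.length ≤ n → (∀ x ∈ l, ∀ y ∈ l, dist x y ≤ d) →
        S (Finsupp.single l 1) ∈ Finsupp.supported R R
          {m | m.length ≤ n ∧ ∀ x ∈ m, ∀ y ∈ m, dist x y ≤ (1 - (n : ℝ)⁻¹) * d}) := by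
  -- Subdivide the boundary recursively and cone it off from the barycenter.
  obtain ⟨S, hS0, hS⟩ := exists_operator (R := R) (V := E) (Finsupp.single [] 1)
    (fun l c => cone (bary l) c)
  have hlen : ∀ {n : ℕ} {v : E} {l : List E}, (v :: l).length = n + 1 →
      bdList R (v :: l) ∈ Finsupp.supported R R {m | m.Sublist (v :: l) ∧ m.length = n} :=
    fun hl => Finsupp.supported_mono (by rintro m ⟨h1, h2⟩; exact ⟨h1, by omega⟩) (bdList_mem _)
  have h_bd : ∀ n, ∀ l : List E, l.length = n →
      bd (S (Finsupp.single l (1 : R))) = S (bd (Finsupp.single l 1)) := by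
    intro n
    induction n with
    | zero =>
      intro l hl
      rw [List.length_eq_zero_iff.1 hl, hS0]
      simp [bdList]
    | succ n ih =>
      rintro (_ | ⟨v, l⟩) hl
      · simp at hl
      have h2 : bd (S (bdList R (v :: l))) = S (bd (bdList R (v :: l))) := by
        have := map_mem_of_mem_supported (N := ⊥) (bd ∘ₗ S - S ∘ₗ bd)
          (A := {m : List E | m.length = n}) (fun m hm => by
            simp only [LinearMap.sub_apply, LinearMap.comp_apply, ih m hm, sub_self,
              Submodule.zero_mem])
          (Finsupp.supported_mono (fun m hm => hm.2) (hlen hl))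
        simpa [sub_eq_zero] using this
      rw [hS, bd_cone, h2, ← bd_single, bd_bd, map_zero, map_zero, sub_zero]
  have h_conv : ∀ T : Set E, Convex ℝ T → ∀ n, ∀ l : List E, l.length = n → (∀ x ∈ l, x ∈ T) →
      S (Finsupp.single l 1) ∈ Finsupp.supported R R {m | m.length = n ∧ ∀ x ∈ m, x ∈ T} := by
    intro T hT n
    induction n with
    | zero =>
      intro l hl h
      rw [List.length_eq_zero_iff.1 hl, hS0]
      exact Finsupp.single_mem_supported _ _ ⟨rfl, by simp⟩
    | succ n ih =>
      rintro (_ | ⟨v, l⟩) hl h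
      · simp at hl
      rw [hS]
      refine cone_mem (A := {m | m.length = n ∧ ∀ x ∈ m, x ∈ T}) ?_
        (map_mem_of_mem_supported S (fun m hm => ?_) (hlen hl))
      · rintro m ⟨hm, h'⟩
        refine ⟨by simp [hm], fun x hx => ?_⟩
        rcases List.mem_cons.1 hx with rfl | hx
        · exact bary_mem hT _ _ h
        · exact h' x hx
      · exact ih m hm.2 (fun x hx => h x (hm.1.subset hx))
  have h_mesh : ∀ (n : ℕ) (d : ℝ), 0 ≤ d → ∀ k, k ≤ n → ∀ l : List E, l.length = k →
      (∀ x ∈ l, ∀ y ∈ l, dist x y ≤ d) → S (Finsupp.single l 1) ∈ Finsupp.supported R R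
          {m | m.length ≤ n ∧ ∀ x ∈ m, ∀ y ∈ m, dist x y ≤ (1 - (n : ℝ)⁻¹) * d} := by
    intro n d hd k
    induction k with
    | zero =>
      intro _ l hl h
      rw [List.length_eq_zero_iff.1 hl, hS0]
      exact Finsupp.single_mem_supported _ _ ⟨by simp, by simp⟩
    | succ k ih =>
      rintro hk (_ | ⟨v, l⟩) hl h
      · simp at hl
      have hk0 : (0 : ℝ) < k + 1 := by positivity
      have hkn : (k + 1 : ℝ) ≤ n := by exact_mod_cast hk
      have hn0 : (0 : ℝ) ≤ (1 - (n : ℝ)⁻¹) * d := by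
        refine mul_nonneg (sub_nonneg.2 (inv_le_one_of_one_le₀ ?_)) hd
        exact le_trans (by simp) hkn
      -- A ball is convex, so the subdivided boundary stays inside it; this bounds the distances to
      -- the new vertex. The other distances come from the induction on the length.
      have hball : ∀ x ∈ v :: l, x ∈ Metric.closedBall (bary (v :: l)) ((1 - (n : ℝ)⁻¹) * d) := by
        intro x hx
        refine (dist_bary_le h hx).trans ?_
        have : (n : ℝ)⁻¹ ≤ ((v :: l).length : ℝ)⁻¹ := by
          rw [hl]; push_cast; gcongr
        gcongr
      rw [hS]
      refine cone_mem (A := {m | (m.length ≤ k ∧ ∀ x ∈ m,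
        x ∈ Metric.closedBall (bary (v :: l)) ((1 - (n : ℝ)⁻¹) * d)) ∧
          ∀ x ∈ m, ∀ y ∈ m, dist x y ≤ (1 - (n : ℝ)⁻¹) * d}) ?_
        (map_mem_of_mem_supported S (fun m hm => ?_) (hlen hl))
      · rintro m ⟨⟨hm, h1⟩, h2⟩
        refine ⟨by simp; omega, fun x hx y hy => ?_⟩
        rcases List.mem_cons.1 hx with rfl | hx <;> rcases List.mem_cons.1 hy with rfl | hy
        · simpa using hn0
        · rw [dist_comm]; exact h1 y hy
        · exact h1 x hx
        · exact h2 x hx y hy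
      · have h1 := h_conv _ (convex_closedBall _ _) k m hm.2 (fun x hx => hball x (hm.1.subset hx))
        have h2 := ih (by omega) m hm.2
          (fun x hx y hy => h x (hm.1.subset hx) y (hm.1.subset hy))
        have h3 := Submodule.mem_inf.2 ⟨h1, h2⟩
        rw [← Finsupp.supported_inter] at h3
        exact Finsupp.supported_mono (by rintro p ⟨⟨e, h4⟩, -, h5⟩; exact ⟨⟨e.le, h4⟩, h5⟩) h3
  refine ⟨S, hS0, fun z => ?_, fun T hT l h => ?_, fun n d hd l hl h => ?_⟩
  · have : bd ∘ₗ S = S ∘ₗ bd := by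
      ext l : 2
      exact h_bd _ l rfl
    exact LinearMap.congr_fun this z
  · exact Finsupp.supported_mono (fun m hm => hm.2) (h_conv T hT _ l rfl h)
  · exact h_mesh n d hd _ hl l rfl h

end Subdivision

end ListChain

namespace ListChain

/-! ### Posets with contractible realization are acyclic -/

section Realization

variable {P : Type*}

/-- The list is not assumed to be a chain, so this face may leave the realization. The comparison
with the identity needs carriers for arbitrary lists. -/
theorem convex_face [Fintype P] (l : List P) :
    Convex ℝ {x : P → ℝ | (∀ p, 0 ≤ x p) ∧ ∑ p, x p = 1 ∧ ∀ p, x p ≠ 0 → p ∈ l} := by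
  rintro x ⟨h0, h1, h2⟩ y ⟨k0, k1, k2⟩ a b ha hb hab
  refine ⟨fun p => ?_, ?_, fun p hp => ?_⟩
  · have := h0 p
    have := k0 p
    simp only [Pi.add_apply, Pi.smul_apply, smul_eq_mul]
    positivity
  · simp only [Pi.add_apply, Pi.smul_apply, smul_eq_mul, Finset.sum_add_distrib, ← Finset.mul_sum,
      h1, k1, mul_one, hab]
  · by_contra h
    have e1 : x p = 0 := by_contra fun h' => h (h2 p h')
    have e2 : y p = 0 := by_contra fun h' => h (k2 p h')
    simp [e1, e2] at hp

open Classical in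
/-- The vertices of the realization. -/
noncomputable def vertex (p : P) : P → ℝ := Pi.single p 1

theorem dist_vertex_le [Fintype P] (p q : P) : dist (vertex p) (vertex q) ≤ 1 := by
  refine (dist_pi_le_iff zero_le_one).2 fun r => ?_
  simp only [vertex, Pi.single_apply]
  split_ifs <;> simp

theorem vertex_mem_face [Fintype P] {l : List P} {p : P} (hp : p ∈ l) :
    vertex p ∈ {x : P → ℝ | (∀ p, 0 ≤ x p) ∧ ∑ p, x p = 1 ∧ ∀ p, x p ≠ 0 → p ∈ l} := by
  refine ⟨fun q => ?_, by simp [vertex], fun q hq => ?_⟩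
  · simp only [vertex, Pi.single_apply]
    split_ifs <;> simp
  · simp only [vertex, Pi.single_apply, ne_eq, ite_eq_right_iff, one_ne_zero, imp_false,
      not_not] at hq
    exact hq ▸ hp

variable [PartialOrder P]

theorem isCompact_posetRealization [Finite P] : IsCompact (posetRealization P) := by
  cases nonempty_fintype P
  refine IsCompact.of_isClosed_subset
    (isCompact_univ_pi (fun _ : P => isCompact_Icc (a := (0 : ℝ)) (b := 1))) ?_ ?_
  -- The chain condition is closed because it says that `x p * x q = 0` for all incomparable `p` and
  -- `q`.
  · have e : posetRealization P = (⋂ p, {x : P → ℝ | 0 ≤ x p}) ∩ ({x | ∑ p, x p = 1} ∩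
        ⋂ p, ⋂ q, {x : P → ℝ | p ≤ q ∨ q ≤ p ∨ x p * x q = 0}) := by
      ext x
      simp only [posetRealization, finsum_eq_sum_of_fintype, Set.mem_ofPred_eq, Set.mem_inter_iff,
        Set.mem_iInter]
      refine and_congr_right fun _ => and_congr_right fun _ => ⟨fun h p q => ?_, ?_⟩
      · by_cases hp : x p = 0
        · simp [hp]
        by_cases hq : x q = 0
        · simp [hq]
        rcases h.total hp hq with h | h
        · exact Or.inl h
        · exact Or.inr (Or.inl h)
      · intro h p hp q hq _
        rcases h p q with h | h | h
        · exact Or.inl h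
        · exact Or.inr h
        · exact absurd h (mul_ne_zero hp hq)
    rw [e]
    refine (isClosed_iInter fun p => isClosed_le continuous_const (continuous_apply p)).inter
      ((isClosed_eq (by fun_prop) continuous_const).inter
        (isClosed_iInter fun p => isClosed_iInter fun q => ?_))
    by_cases h1 : p ≤ q
    · simp [h1]
    by_cases h2 : q ≤ p
    · simp [h2]
    simp only [h1, h2, false_or]
    exact isClosed_eq (by fun_prop) continuous_const
  · rintro x ⟨h0, h1, -⟩ p -
    rw [finsum_eq_sum_of_fintype] at h1
    exact ⟨h0 p, h1 ▸ Finset.single_le_sum (fun q _ => h0 q) (Finset.mem_univ p)⟩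

/-- The coordinates sum to one, so they cannot all be below average. The vertex obtained serves as
the rounding of `x`. -/
theorem exists_le_coord [Fintype P] {x : P → ℝ} (hx : x ∈ posetRealization P) :
    ∃ p, (Fintype.card P : ℝ)⁻¹ ≤ x p := by
  obtain ⟨-, h1, -⟩ := hx
  rw [finsum_eq_sum_of_fintype] at h1
  by_contra! h
  have hne : Nonempty P := by
    by_contra h
    rw [not_nonempty_iff] at h
    simp at h1
  have := Finset.sum_lt_sum_of_nonempty Finset.univ_nonempty (fun p _ => h p)
  rw [h1] at this
  simp at this

/-- Vertices carrying large coordinates of nearby points of the realization are comparable. -/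
theorem comparable_of_dist_lt [Fintype P] {x y : P → ℝ} (hy : y ∈ posetRealization P) {p q : P}
    (hp : (Fintype.card P : ℝ)⁻¹ ≤ x p) (hq : (Fintype.card P : ℝ)⁻¹ ≤ y q)
    (h : dist x y < (Fintype.card P : ℝ)⁻¹) : p ≤ q ∨ q ≤ p := by
  have h1 := (dist_le_pi_dist x y p).trans_lt h
  rw [Real.dist_eq, abs_lt] at h1
  have h2 : 0 < (Fintype.card P : ℝ)⁻¹ := lt_of_le_of_lt dist_nonneg h
  -- Both `y p` and `y q` are positive, so `p` and `q` lie in the support of `y`, which is a chain.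
  exact hy.2.2.total (by simp only [Set.mem_ofPred_eq]; linarith [h1.2])
    (by simp only [Set.mem_ofPred_eq]; linarith)

theorem mem_posetRealization_of_subset [Fintype P] {l : List P}
    (hl : l ∈ cliques fun a b : P => a ≤ b ∨ b ≤ a) {x : P → ℝ} (h0 : ∀ p, 0 ≤ x p)
    (h1 : ∑ p, x p = 1) (h2 : ∀ p, x p ≠ 0 → p ∈ l) : x ∈ posetRealization P :=
  ⟨h0, by rwa [finsum_eq_sum_of_fintype], fun p hp q hq _ => hl p (h2 p hp) q (h2 q hq)⟩

/-- A chain map on chains of points given by a fine subdivision. -/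
theorem exists_fine_subdivision (R : Type*) [CommRing R] {E : Type*} [NormedAddCommGroup E]
    [NormedSpace ℝ E] (n : ℕ) {δ : ℝ} (hδ : 0 < δ) : ∃ S : (List E →₀ R) →ₗ[R] (List E →₀ R),
      S (Finsupp.single [] 1) = Finsupp.single [] 1 ∧ (∀ z, bd (S z) = S (bd z)) ∧
      (∀ T : Set E, Convex ℝ T → ∀ l : List E, (∀ x ∈ l, x ∈ T) →
        S (Finsupp.single l 1) ∈ Finsupp.supported R R {m | ∀ x ∈ m, x ∈ T}) ∧
      (∀ l : List E, l.length ≤ n → (∀ x ∈ l, ∀ y ∈ l, dist x y ≤ 1) →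
        S (Finsupp.single l 1) ∈ Finsupp.supported R R
          {m | ∀ x ∈ m, ∀ y ∈ m, dist x y < δ}) := by
  obtain ⟨S, h1, h2, h3, h4⟩ := exists_subdivision R E
  -- The bound `n + 1` replaces `n` because for `n = 0` the contraction factor would be `1`.
  set c : ℝ := 1 - ((n + 1 : ℕ) : ℝ)⁻¹ with hc
  have hc1 : c < 1 := by rw [hc]; simp; positivity
  have hc0 : 0 ≤ c := by
    rw [hc, sub_nonneg]
    exact inv_le_one_of_one_le₀ (by simp)
  obtain ⟨k, hk⟩ := exists_pow_lt_of_lt_one hδ hc1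
  refine ⟨S ^ k, ?_, fun z => ?_, fun T hT l hl => ?_, fun l hl h => ?_⟩
  · clear hk
    induction k with
    | zero => rfl
    | succ k ih => rw [pow_succ, Module.End.mul_apply, h1, ih]
  · clear hk
    induction k generalizing z with
    | zero => rfl
    | succ k ih => rw [pow_succ, Module.End.mul_apply, ih, h2, Module.End.mul_apply]
  · clear hk
    induction k with
    | zero => exact Finsupp.single_mem_supported _ _ hl
    | succ k ih =>
      rw [pow_succ', Module.End.mul_apply]
      exact map_mem_of_mem_supported S (fun m hm => h3 T hT m hm) ih
  · have key : (S ^ k) (Finsupp.single l 1) ∈ Finsupp.supported R R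
        {m | m.length ≤ n + 1 ∧ ∀ x ∈ m, ∀ y ∈ m, dist x y ≤ c ^ k} := by
      clear hk
      induction k with
      | zero =>
        exact Finsupp.single_mem_supported _ _ ⟨by omega, fun x hx y hy => by simpa using h x hx y hy⟩
      | succ k ih =>
        rw [pow_succ' c, pow_succ' S, Module.End.mul_apply]
        exact map_mem_of_mem_supported S (fun m hm => h4 (n + 1) _ (by positivity) m hm.1 hm.2) ih
    exact Finsupp.supported_mono (fun m hm x hx y hy => (hm.2 x hx y hy).trans_lt hk) key

/-- The ordered chain complex of a finite poset with contractible realization is exact. -/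
theorem isAcyclic_of_contractibleSpace (R : Type*) [CommRing R] [Finite P]
    [ContractibleSpace (posetRealization P)] :
    IsAcyclic R (fun a b : P => a ≤ b ∨ b ≤ a) := by
  cases nonempty_fintype P
  intro z hz hbd
  have : CompactSpace (posetRealization P) :=
    isCompact_iff_compactSpace.1 isCompact_posetRealization
  obtain ⟨x₀, ⟨H⟩⟩ := id_nullhomotopic (posetRealization P)
  obtain ⟨p₀, -⟩ := exists_le_coord x₀.2
  have hcard : (0 : ℝ) < (Fintype.card P : ℝ)⁻¹ := by
    have : 0 < Fintype.card P := Fintype.card_pos_iff.2 ⟨p₀⟩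
    positivity
  -- Points and times closer than `δ` have images within the distance at which rounded vertices are
  -- comparable.
  obtain ⟨δ, hδ, hH⟩ := Metric.uniformContinuous_iff.1
    (CompactSpace.uniformContinuous_of_continuous H.continuous) _ hcard
  choose φ hφ using fun x : posetRealization P => exists_le_coord x.2
  obtain ⟨m, hm⟩ := exists_nat_gt δ⁻¹
  have hm0 : (0 : ℝ) < m := (inv_pos.2 hδ).trans hm
  -- Projecting to the unit interval defines `t i` for every `i`, and being 1-Lipschitz it keeps the
  -- time steps below `δ`.
  let t : ℕ → unitInterval := fun i => Set.projIcc 0 1 zero_le_one (i / m : ℝ)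
  have ht : ∀ i, dist (t i) (t (i + 1)) < δ := by
    intro i
    refine lt_of_le_of_lt (LipschitzWith.dist_le_mul (LipschitzWith.projIcc _) _ _) ?_
    rw [NNReal.coe_one, one_mul, Real.dist_eq, ← sub_div, Nat.cast_add, Nat.cast_one,
      sub_add_cancel_left, abs_div, abs_neg, abs_one, abs_of_pos hm0, one_div]
    exact inv_lt_of_inv_lt₀ hδ hm
  have ht0 : t 0 = 0 := by simp [t, Set.projIcc_left]
  have htm : t m = 1 := by simp [t, div_self hm0.ne', Set.projIcc_right]
  classical
  -- Off the realization the value is still an index with nonzero coordinate, so that `f 0` respects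
  -- the faces of lists that are not chains. The value `p₀` occurs only at the zero vector.
  let f : ℕ → (P → ℝ) → P := fun i x =>
    if h : x ∈ posetRealization P then φ (H (t i, ⟨x, h⟩))
    else if h' : ∃ p, x p ≠ 0 then h'.choose else p₀
  have hf : ∀ i x (h : x ∈ posetRealization P), f i x = φ (H (t i, ⟨x, h⟩)) :=
    fun i x h => dif_pos h
  -- The cycle has finite support, so its lists have bounded length and a single depth of
  -- subdivision suffices.
  obtain ⟨S, hS0, hSbd, hSconv, hSmesh⟩ := exists_fine_subdivision R (E := P → ℝ)
    (z.support.sup List.length) hδ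
  set r : P → P → Prop := fun a b => a ≤ b ∨ b ≤ a with hr
  have hface : ∀ l : List P, S (push vertex (Finsupp.single l 1)) ∈ Finsupp.supported R R
      {k | ∀ x ∈ k, x ∈ {x : P → ℝ | (∀ p, 0 ≤ x p) ∧ ∑ p, x p = 1 ∧ ∀ p, x p ≠ 0 → p ∈ l}} := by
    intro l
    rw [push_single]
    refine hSconv _ (convex_face l) _ fun x hx => ?_
    obtain ⟨p, hp, rfl⟩ := List.mem_map.1 hx
    exact vertex_mem_face hp
  set y := S (push vertex z) with hy
  have hybd : bd y = 0 := by rw [hy, hSbd, bd_push, hbd, map_zero, map_zero]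
  have hysupp : y ∈ Finsupp.supported R R
      {k | (∀ x ∈ k, x ∈ posetRealization P) ∧ ∀ x ∈ k, ∀ y ∈ k, dist x y < δ} := by
    have hz' : z ∈ Finsupp.supported R R (cliques r ∩ z.support) := by
      rw [Finsupp.supported_inter]
      exact ⟨hz, Finsupp.mem_supported_support R z⟩
    refine map_mem_of_mem_supported (S ∘ₗ push vertex) (fun l hl => ?_) hz'
    refine (Finsupp.supported_inter (M := R) (R := R) _ _).ge ⟨?_, ?_⟩
    · refine Finsupp.supported_mono (fun k hk x hx => ?_) (hface l)
      obtain ⟨h0, h1, h2⟩ := hk x hx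
      exact mem_posetRealization_of_subset hl.1 h0 h1 h2
    · rw [LinearMap.comp_apply, push_single]
      refine hSmesh _ ?_ ?_
      · rw [List.length_map]
        exact Finset.le_sup (f := List.length) hl.2
      · intro x hx y hy
        obtain ⟨p, -, rfl⟩ := List.mem_map.1 hx
        obtain ⟨q, -, rfl⟩ := List.mem_map.1 hy
        exact dist_vertex_le p q
  let N : Submodule R (List P →₀ R) := (Finsupp.supported R R (cliques r)).map bd
  -- All entries of a prism list come from points of one small list at two adjacent times, so they
  -- are pairwise comparable and the prism stays among the cliques.
  have hstep : ∀ i, push (f (i + 1)) y - push (f i) y ∈ N := by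
    intro i
    refine ⟨prism (f i) (f (i + 1)) y, prism_mem ?_ hysupp, ?_⟩
    · rintro l ⟨hl, hl'⟩ k hk
      have key : ∀ a ∈ k, ∃ s : unitInterval, (s = t i ∨ s = t (i + 1)) ∧
          ∃ x : posetRealization P, x.1 ∈ l ∧ a = φ (H (s, x)) := by
        intro a ha
        obtain ⟨x, hx, h | h⟩ := hk a ha
        · exact ⟨t i, Or.inl rfl, ⟨x, hl x hx⟩, hx, h.trans (hf i x (hl x hx))⟩
        · exact ⟨t (i + 1), Or.inr rfl, ⟨x, hl x hx⟩, hx, h.trans (hf (i + 1) x (hl x hx))⟩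
      intro a ha b hb
      obtain ⟨s, hs, x, hx, rfl⟩ := key a ha
      obtain ⟨s', hs', x', hx', rfl⟩ := key b hb
      refine comparable_of_dist_lt (H (s', x')).2 (hφ _) (hφ _) (hH ?_)
      rw [Prod.dist_eq]
      refine max_lt ?_ (hl' _ hx _ hx')
      rcases hs with rfl | rfl <;> rcases hs' with rfl | rfl
      · simpa using hδ
      · exact ht i
      · rw [dist_comm]; exact ht i
      · simpa using hδ
    · rw [bd_prism, hybd, map_zero, sub_zero]
  -- At time zero the homotopy is the identity, so a point is rounded to a vertex of its own face.
  -- Subdividing and rounding is then carried by each list, hence homotopic to the identity.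
  have h0 : push (f 0) y - z ∈ N := by
    obtain ⟨T, hT, hT'⟩ := exists_homotopy_of_carried (push (f 0) ∘ₗ S ∘ₗ push vertex)
      (fun z => by simp only [LinearMap.comp_apply, bd_push, hSbd]) (by simp [hS0])
      (fun l => push_mem (fun k hk a ha => by
        obtain ⟨x, hx, rfl⟩ := List.mem_map.1 ha
        obtain ⟨-, h1, h2⟩ := hk x hx
        refine h2 _ ?_
        by_cases h : x ∈ posetRealization P
        · rw [hf 0 x h, ht0, H.apply_zero]
          exact (hcard.trans_le (hφ ⟨x, h⟩)).ne'
        · have h' : ∃ p, x p ≠ 0 := by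
            by_contra! h'
            simp [h'] at h1
          simp only [f, dif_neg h, dif_pos h']
          exact h'.choose_spec) (hface l))
    refine ⟨T z, map_mem_of_mem_supported T (fun l hl => ?_) hz, ?_⟩
    · exact Finsupp.supported_mono (fun k hk => cliques_of_subset hl hk) (hT' l)
    · rw [hT, hbd, map_zero, sub_zero]
      rfl
  -- At time one every point is rounded to `φ x₀`, and the cone from this vertex bounds the
  -- resulting cycle.
  have hlast : push (f m) y ∈ N := by
    refine ⟨cone (φ x₀) (push (f m) y), cone_mem (A := {k | ∀ a ∈ k, a = φ x₀}) ?_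
      (push_mem ?_ hysupp), ?_⟩
    · intro k hk a ha b hb
      have : ∀ c ∈ φ x₀ :: k, c = φ x₀ := by simpa using hk
      rw [this a ha, this b hb]
      exact Or.inl le_rfl
    · rintro l ⟨hl, -⟩ a ha
      obtain ⟨x, hx, rfl⟩ := List.mem_map.1 ha
      rw [hf m x (hl x hx), htm]
      simp
    · rw [bd_cone, bd_push, hybd, map_zero, map_zero, sub_zero]
  have hall : ∀ i, push (f i) y - z ∈ N := by
    intro i
    induction i with
    | zero => exact h0
    | succ i ih => simpa using N.add_mem (hstep i) ih
  obtain ⟨w, hw, hw'⟩ := N.sub_mem hlast (hall m)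
  exact ⟨w, hw, by rw [hw']; abel⟩

end Realization

end ListChain

/-! ### Comparison of extension groups along an exact functor -/

section ExtComparison

open Abelian

universe w w' v v' u₁ u₂

variable {A : Type u₁} [Category.{v} A] [Abelian A] {B : Type u₂} [Category.{v'} B] [Abelian B]

attribute [local instance] Ext.subsingleton_of_projective in
attribute [local simp] Ext.mapExactFunctor_comp Ext.mapExactFunctor_mk₀
  Ext.mapExactFunctor_extClass in
/-- An exact functor induces isomorphisms of extension groups out of the syzygies of a resolution
which is projective on both sides and on which it induces bijections of morphisms. -/
theorem mapExt_bijective_of_resolution (Φ : A ⥤ B) [Φ.Additive] [PreservesFiniteLimits Φ]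
    [PreservesFiniteColimits Φ] [HasExt.{w} A] [HasExt.{w'} B] (Y : A) (S : ℕ → ShortComplex A)
    (hS : ∀ m, (S m).ShortExact) (e : ∀ m, (S m).X₁ = (S (m + 1)).X₃)
    (hproj : ∀ m, Projective (S m).X₂) (hproj' : ∀ m, Projective (Φ.obj (S m).X₂))
    (hbij : ∀ m, Function.Bijective fun f : (S m).X₂ ⟶ Y => Φ.map f) (n m : ℕ) :
    Function.Bijective (Φ.mapExtAddHom (S m).X₃ Y n) := by
  induction n generalizing m with
  | zero =>
    -- Injectivity descends along the epimorphism from `X₂` to `X₃`. Applied to the next syzygy,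
    -- which is `X₁`, it shows that a morphism lifted from `X₂` kills `X₁` and factors through `X₃`.
    have hinj : ∀ m, Function.Injective fun f : (S m).X₃ ⟶ Y => Φ.map f := by
      intro m f g h
      have := (hS m).epi_g
      rw [← cancel_epi (S m).g]
      apply (hbij m).1
      simp only [Functor.map_comp]
      exact congrArg _ h
    have hinj' : ∀ m, Function.Injective fun f : (S m).X₁ ⟶ Y => Φ.map f := by
      intro m
      rw [e m]
      exact hinj (m + 1)
    have hb : Function.Bijective fun f : (S m).X₃ ⟶ Y => Φ.map f := by
      refine ⟨hinj m, fun f => ?_⟩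
      have := (hS m).epi_g
      obtain ⟨g, hg⟩ := (hbij m).2 (Φ.map (S m).g ≫ f)
      have h0 : (S m).f ≫ g = 0 := by
        apply hinj' m
        dsimp only at hg ⊢
        rw [Functor.map_comp, hg, ← Category.assoc, ← Functor.map_comp, (S m).zero,
          Functor.map_zero, Functor.map_zero, zero_comp]
      refine ⟨(hS m).exact.desc g h0, ?_⟩
      dsimp only
      rw [← cancel_epi (Φ.map (S m).g), ← Functor.map_comp, (hS m).exact.g_desc]
      exact hg
    simpa [Ext.mapExactFunctor₀] using hb
  | succ n hn =>
    have hn' : Function.Bijective (Φ.mapExtAddHom (S m).X₁ Y n) := by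
      rw [e m]
      exact hn (m + 1)
    have := (hS m).mono_f
    have := (hS m).epi_g
    have hP := hproj m
    have : Projective ((S m).map Φ).X₂ := hproj' m
    -- Since `X₂` is projective on both sides, the next extension group of `X₃` is the cokernel of
    -- the map from that of `X₂` to that of `X₁` in degree `n`. Comparing cokernels needs only
    -- surjectivity at `X₂`.
    have hb2 : Function.Surjective (Φ.mapExtAddHom (S m).X₂ Y n) := by
      cases n with
      | zero => simpa [Ext.mapExactFunctor₀] using (hbij m).2
      | succ n =>
        have : Subsingleton (Ext ((S m).map Φ).X₂ (Φ.obj Y) (n + 1)) := inferInstance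
        exact fun x => ⟨0, Subsingleton.elim (α := Ext ((S m).map Φ).X₂ (Φ.obj Y) (n + 1)) _ _⟩
    exact AddMonoidHom.bijective_of_surjective_of_bijective_of_right_exact _ _ _ _
      (Φ.mapExtAddHom (S m).X₂ Y n) (Φ.mapExtAddHom (S m).X₁ Y n)
      (Φ.mapExtAddHom (S m).X₃ Y (n + 1))
      (by cat_disch) (by cat_disch)
      ((ShortComplex.ab_exact_iff_function_exact _).1
        (Ext.contravariant_sequence_exact₁' (hS m) Y n (n + 1) (add_comm 1 n)))
      ((ShortComplex.ab_exact_iff_function_exact _).1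
        (Ext.contravariant_sequence_exact₁' ((hS m).map Φ) (Φ.obj Y) n (n + 1) (add_comm 1 n)))
      hb2 hn'
      (fun x₃ ↦ Ext.contravariant_sequence_exact₃ (hS m) _ x₃ (by subsingleton) (add_comm 1 n))
      (fun y₃ ↦ Ext.contravariant_sequence_exact₃ ((hS m).map Φ) _ y₃ (by subsingleton)
        (add_comm 1 n))

/-- A complex in a functor category is short exact if it is so pointwise. -/
theorem shortExact_of_evaluation {J : Type*} [Category* J] (S : ShortComplex (J ⥤ A))
    (h : ∀ j, (S.map ((evaluation J A).obj j)).ShortExact) : S.ShortExact where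
  exact := by
    rw [ShortComplex.exact_iff_isZero_homology]
    refine Functor.isZero _ fun j => ?_
    exact (((S.map _).exact_iff_isZero_homology).1 (h j).exact).of_iso
      (S.mapHomologyIso ((evaluation J A).obj j)).symm
  mono_f := by
    have : ∀ j, Mono (S.f.app j) := fun j => (h j).mono_f
    exact NatTrans.mono_of_mono_app _
  epi_g := by
    have : ∀ j, Epi (S.g.app j) := fun j => (h j).epi_g
    exact NatTrans.epi_of_epi_app _

end ExtComparison

/-! ### A resolution of the constant module -/

namespace ArrowChain

open ListChain

noncomputable section

variable (R : Type u) [CommRing R] {D : Type u} [SmallCategory D] {B : Type u} (o : B → D)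

/-- The arrows from `w` to the objects of the family `o`. -/
abbrev ArrowTo (w : D) : Type u := Σ b : B, (w ⟶ o b)

variable {o}

/-- Precomposition of arrows. -/
def pull {v w : D} (k : v ⟶ w) (x : ArrowTo o w) : ArrowTo o v := ⟨x.1, k ≫ x.2⟩

theorem pull_id (w : D) : pull (o := o) (𝟙 w) = id := by
  funext x
  simp [pull]

theorem pull_comp {v w x : D} (k : v ⟶ w) (h : w ⟶ x) :
    pull (o := o) (k ≫ h) = pull k ∘ pull h := by
  funext y
  simp [pull]

/-- `y` factors through `x`. -/
def Factors {w : D} (x y : ArrowTo o w) : Prop := ∃ h : o x.1 ⟶ o y.1, x.2 ≫ h = y.2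

theorem Factors.refl {w : D} (x : ArrowTo o w) : Factors x x := ⟨𝟙 _, Category.comp_id _⟩

theorem Factors.trans {w : D} {x y z : ArrowTo o w} : Factors x y → Factors y z → Factors x z := by
  rintro ⟨h, e⟩ ⟨k, e'⟩
  exact ⟨h ≫ k, by rw [← Category.assoc, e, e']⟩

/-- An epimorphism can be cancelled from both sides of a factorization. Thus comparability and
minimality of entries do not change under precomposition. -/
theorem factors_pull_iff {v w : D} (k : v ⟶ w) [Epi k] {x y : ArrowTo o w} :
    Factors (pull k x) (pull k y) ↔ Factors x y := by
  obtain ⟨b, f⟩ := x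
  obtain ⟨c, g⟩ := y
  change (∃ h : o b ⟶ o c, (k ≫ f) ≫ h = k ≫ g) ↔ ∃ h : o b ⟶ o c, f ≫ h = g
  simp only [Category.assoc, cancel_epi]

variable (o) in
/-- One of the two arrows factors through the other. -/
def Comparable (w : D) (x y : ArrowTo o w) : Prop := Factors x y ∨ Factors y x

variable (o) in
/-- The lists of `n` pairwise comparable arrows. -/
def cells (n : ℕ) (w : D) : Set (List (ArrowTo o w)) :=
  cliques (Comparable o w) ∩ {l | l.length = n}

theorem map_pull_mem_cells_iff {v w : D} (k : v ⟶ w) [Epi k] {n : ℕ} {l : List (ArrowTo o w)} :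
    l.map (pull k) ∈ cells o n v ↔ l ∈ cells o n w := by
  simp only [cells, cliques, Comparable, Set.mem_inter_iff, Set.mem_ofPred_eq, List.length_map,
    List.forall_mem_map, factors_pull_iff]

/-- On the entries of a cell `Factors` is a total preorder, and a nonempty finite one has a least
element. -/
theorem exists_factors_of_mem_cells {n : ℕ} {w : D} {l : List (ArrowTo o w)}
    (hl : l ∈ cells o (n + 1) w) : ∃ x ∈ l, ∀ y ∈ l, Factors x y := by
  induction n generalizing l with
  | zero =>
    obtain ⟨x, rfl⟩ := List.length_eq_one_iff.1 hl.2
    exact ⟨x, by simp, by simpa using Factors.refl x⟩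
  | succ n ih =>
    obtain ⟨hl, hn⟩ := hl
    cases l with
    | nil => simp at hn
    | cons a l =>
      obtain ⟨x, hx, h⟩ := ih (l := l) ⟨cliques_of_subset hl (by simp), by simpa using hn⟩
      rcases hl a (by simp) x (by simp [hx]) with h' | h'
      · refine ⟨a, by simp, fun y hy => ?_⟩
        rcases List.mem_cons.1 hy with rfl | hy
        · exact Factors.refl _
        · exact h'.trans (h y hy)
      · refine ⟨x, by simp [hx], fun y hy => ?_⟩
        rcases List.mem_cons.1 hy with rfl | hy
        · exact h'
        · exact h y hy

open Classical in
/-- The arrow through which `y` factors over `f`. -/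
def quotArrow {w : D} {b : B} (f : w ⟶ o b) (y : ArrowTo o w) : ArrowTo o (o b) :=
  if h : ∃ h : o b ⟶ o y.1, f ≫ h = y.2 then ⟨y.1, h.choose⟩ else ⟨b, 𝟙 _⟩

theorem pull_quotArrow {w : D} {b : B} {f : w ⟶ o b} {y : ArrowTo o w}
    (h : ∃ h : o b ⟶ o y.1, f ≫ h = y.2) : pull f (quotArrow f y) = y := by
  rw [quotArrow, dif_pos h, pull, h.choose_spec]

theorem quotArrow_pull {v w : D} (k : v ⟶ w) [Epi k] {b : B} (f : w ⟶ o b) (y : ArrowTo o w) :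
    quotArrow (k ≫ f) (pull k y) = quotArrow f y := by
  obtain ⟨c, g⟩ := y
  have e : (fun h : o b ⟶ o c => (k ≫ f) ≫ h = k ≫ g) = fun h => f ≫ h = g := by
    funext h
    rw [Category.assoc, cancel_epi]
  classical
  -- The two sides choose from predicates that are equal as functions, so rewriting one into the
  -- other makes the chosen arrows coincide.
  change (if h : ∃ h, (fun h : o b ⟶ o c => (k ≫ f) ≫ h = k ≫ g) h then
    (⟨c, h.choose⟩ : ArrowTo o (o b)) else ⟨b, 𝟙 _⟩) =
      if h : ∃ h, (fun h : o b ⟶ o c => f ≫ h = g) h then ⟨c, h.choose⟩ else ⟨b, 𝟙 _⟩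
  rw [e]

/-- An arrow `w ⟶ o b` together with a list of arrows from `o b`. -/
abbrev Normalized (o : B → D) (w : D) : Type u := Σ b : B, (w ⟶ o b) × List (ArrowTo o (o b))

open Classical in
/-- The factorization of a list of arrows over its first minimal entry. -/
def normalize {w : D} (l : List (ArrowTo o w)) : Option (Normalized o w) :=
  (l.find? fun x => ∀ y ∈ l, Factors x y).map fun x => ⟨x.1, x.2, l.map (quotArrow x.2)⟩

/-- Precomposition keeps the position of the first minimal entry and changes only the arrow
component. This naturality allows morphisms out of the chains to be prescribed on normalized lists.
-/
theorem normalize_map_pull {v w : D} (k : v ⟶ w) [Epi k] (l : List (ArrowTo o w)) :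
    normalize (l.map (pull k)) =
      (normalize l).map fun t => (⟨t.1, k ≫ t.2.1, t.2.2⟩ : Normalized o v) := by
  classical
  unfold normalize
  rw [List.find?_map, Option.map_map, Option.map_map]
  have e : ((fun x => decide (∀ y ∈ l.map (pull k), Factors x y)) ∘ pull k) =
      fun x => decide (∀ y ∈ l, Factors x y) := by
    funext x
    simp only [Function.comp_apply, List.forall_mem_map, factors_pull_iff]
  simp only [e]
  congr 1
  funext x
  have e' : quotArrow (k ≫ x.2) ∘ pull k = quotArrow x.2 := funext fun y => quotArrow_pull k x.2 y
  simp only [Function.comp_apply, List.map_map]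
  change (⟨x.1, k ≫ x.2, List.map (quotArrow (k ≫ x.2) ∘ pull k) l⟩ : Normalized o v) = _
  rw [e']

/-- Dividing all entries by a least one yields a cell based at an object of the family, because
pulling back reflects cells. Every chain is thus generated from such objects. -/
theorem exists_normalize {n : ℕ} {w : D} (hepi : ∀ {v w : D} (k : v ⟶ w), Epi k)
    {l : List (ArrowTo o w)} (hl : l ∈ cells o (n + 1) w) :
    ∃ (b : B) (f : w ⟶ o b) (m : List (ArrowTo o (o b))), normalize l = some ⟨b, f, m⟩ ∧
      m ∈ cells o (n + 1) (o b) ∧ m.map (pull f) = l := by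
  classical
  have h1 : (l.find? fun x => ∀ y ∈ l, Factors x y).isSome := by
    simpa using exists_factors_of_mem_cells hl
  obtain ⟨x, hx⟩ := Option.isSome_iff_exists.1 h1
  have h2 : ∀ y ∈ l, Factors x y := by simpa using List.find?_some hx
  have h3 : (l.map (quotArrow x.2)).map (pull x.2) = l := by
    rw [List.map_map]
    conv_rhs => rw [← List.map_id l]
    exact List.map_congr_left fun y hy => pull_quotArrow (h2 y hy)
  refine ⟨x.1, x.2, l.map (quotArrow x.2), by simp only [normalize, hx]; rfl, ?_, h3⟩
  have := hepi x.2
  rw [← map_pull_mem_cells_iff x.2, h3]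
  exact hl

/-! #### Modules of chains -/

variable {R}

/-- The module given by a family of submodules of chains of arrows closed under precomposition. -/
def chainModule (N : ∀ w : D, Submodule R (List (ArrowTo o w) →₀ R))
    (hN : ∀ {v w : D} (k : v ⟶ w), ∀ z ∈ N w, push (pull k) z ∈ N v) : RMod R D where
  obj w := ModuleCat.of R (N w.unop)
  map k := ModuleCat.ofHom ((push (pull k.unop)).restrict (hN k.unop))
  map_id w := by
    refine ModuleCat.hom_ext (LinearMap.ext fun z => Subtype.ext ?_)
    change push (pull (𝟙 w.unop)) z.1 = z.1
    rw [pull_id, push_id]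
  map_comp k h := by
    refine ModuleCat.hom_ext (LinearMap.ext fun z => Subtype.ext ?_)
    change push (pull (h.unop ≫ k.unop)) z.1 = push (pull h.unop) (push (pull k.unop) z.1)
    rw [pull_comp, push_push]

variable (R o)

/-- The chains of degree `n`, spanned by the lists of `n + 1` pairwise comparable arrows. -/
def chains (hepi : ∀ {v w : D} (k : v ⟶ w), Epi k) (n : ℕ) : RMod R D :=
  chainModule (fun w => Finsupp.supported R R (cells o (n + 1) w)) (fun k z hz =>
    push_mem (fun l hl => by have := hepi k; exact (map_pull_mem_cells_iff k).2 hl) hz)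

/-- The cycles of degree `n - 1`. -/
def cycles (hepi : ∀ {v w : D} (k : v ⟶ w), Epi k) (n : ℕ) : RMod R D :=
  chainModule (fun w => Finsupp.supported R R (cells o n w) ⊓ LinearMap.ker bd)
    (fun k z hz => ⟨push_mem (fun l hl => by
        have := hepi k
        exact (map_pull_mem_cells_iff k).2 hl) hz.1,
      LinearMap.mem_ker.2 (by rw [bd_push, LinearMap.mem_ker.1 hz.2, map_zero])⟩)

variable (hepi : ∀ {v w : D} (k : v ⟶ w), Epi k)

/-- The inclusion of the cycles in the chains. -/
def cyclesIncl (n : ℕ) : cycles R o hepi (n + 1) ⟶ chains R o hepi n where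
  app _ := ModuleCat.ofHom (Submodule.inclusion inf_le_left)
  naturality _ _ _ := rfl

theorem bd_mem_cycles {n : ℕ} {w : D} {z : List (ArrowTo o w) →₀ R}
    (hz : z ∈ Finsupp.supported R R (cells o (n + 1) w)) :
    bd z ∈ Finsupp.supported R R (cells o n w) ⊓ LinearMap.ker bd :=
  ⟨bd_mem (B := cells o n w) (fun _ hl _ hm hlen => ⟨cliques_of_subset hl.1 hm.subset,
    Nat.succ_injective (hlen.trans hl.2)⟩) hz, bd_bd z⟩

/-- The boundary map from chains to cycles. -/
def chainsBd (n : ℕ) : chains R o hepi n ⟶ cycles R o hepi n where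
  app w := ModuleCat.ofHom (bd.restrict fun _ hz => bd_mem_cycles R o hz)
  naturality _ _ k := by
    exact ModuleCat.hom_ext (LinearMap.ext fun z => Subtype.ext (bd_push _ z.1))

/-- The short complex of cycles, chains and cycles. -/
def cyclesComplex (n : ℕ) : ShortComplex (RMod R D) where
  X₁ := cycles R o hepi (n + 1)
  X₂ := chains R o hepi n
  X₃ := cycles R o hepi n
  f := cyclesIncl R o hepi n
  g := chainsBd R o hepi n
  zero := by
    ext w : 2
    exact ModuleCat.hom_ext (LinearMap.ext fun z => Subtype.ext z.2.2)

theorem cyclesComplex_shortExact (h : ∀ w : D, IsAcyclic R (Comparable o w)) (n : ℕ) :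
    (cyclesComplex R o hepi n).ShortExact := by
  refine shortExact_of_evaluation _ fun w => ?_
  refine { exact := ?_, mono_f := ?_, epi_g := ?_ }
  · refine (ShortComplex.moduleCat_exact_iff _).2 fun z hz => ?_
    exact ⟨⟨z.1, z.2, congrArg Subtype.val hz⟩, rfl⟩
  · exact (ModuleCat.mono_iff_injective _).2 (Submodule.inclusion_injective inf_le_left)
  · refine (ModuleCat.epi_iff_surjective _).2 ?_
    rintro ⟨z, hz, hbd⟩
    obtain ⟨y, hy, e⟩ := h w.unop z (Finsupp.supported_mono Set.inter_subset_left hz) hbd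
    -- Acyclicity is stated without a grading, so only the part of `y` in the right degree is kept.
    have hz' : bd (y.filter fun l => l.length = n + 1) = z := by
      rw [bd_filter_length, e, Finsupp.filter_eq_self_iff]
      exact fun l hl => (hz (Finsupp.mem_support_iff.2 hl)).2
    have hy' : (y.filter fun l => l.length = n + 1) ∈
        Finsupp.supported R R (cells o (n + 1) w.unop) := by
      intro l hl
      rw [Finsupp.support_filter] at hl
      have hl := Finset.mem_filter.1 hl
      exact ⟨hy hl.1, hl.2⟩
    exact ⟨⟨_, hy'⟩, Subtype.ext hz'⟩

variable {R o}

/-- The basis element of a list of comparable arrows. -/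
def basisChain {n : ℕ} {w : D} {l : List (ArrowTo o w)} (hl : l ∈ cells o (n + 1) w) :
    (chains R o hepi n).obj (Opposite.op w) :=
  ⟨Finsupp.single l 1, Finsupp.single_mem_supported _ _ hl⟩

theorem map_basisChain {n : ℕ} {v w : D} (k : v ⟶ w) {l : List (ArrowTo o w)}
    (hl : l ∈ cells o (n + 1) w) (hl' : l.map (pull k) ∈ cells o (n + 1) v) :
    (chains R o hepi n).map k.op (basisChain hepi hl) = basisChain hepi hl' :=
  Subtype.ext (push_single _ _ _)

theorem chains_hom_ext {n : ℕ} {w : D} {M : ModuleCat.{u} R}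
    {f g : (chains R o hepi n).obj (Opposite.op w) ⟶ M}
    (h : ∀ (l : List (ArrowTo o w)) (hl : l ∈ cells o (n + 1) w),
      f (basisChain hepi hl) = g (basisChain hepi hl)) : f = g := by
  ext ⟨z, hz⟩
  -- Membership in the equalizer of `f` and `g` becomes vanishing in a quotient of all chains, which
  -- can be tested on lists.
  let L : (List (ArrowTo o w) →₀ R) →ₗ[R] (List (ArrowTo o w) →₀ R) ⧸
    ((LinearMap.eqLocus f.hom g.hom).map (Submodule.subtype _)) := Submodule.mkQ _
  have : L z ∈ (⊥ : Submodule R _) := map_mem_of_mem_supported L (fun l hl => by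
    rw [Submodule.mem_bot, Submodule.mkQ_apply, Submodule.Quotient.mk_eq_zero]
    exact ⟨_, h l hl, rfl⟩) hz
  rw [Submodule.mem_bot, Submodule.mkQ_apply, Submodule.Quotient.mk_eq_zero] at this
  obtain ⟨z', hz', rfl⟩ := this
  exact hz'

end

end ArrowChain

/-! ### Freeness of the chain modules over full subcategories -/

namespace ArrowChain

open ListChain

noncomputable section

section Restriction

variable {R : Type u} [CommRing R] {D : Type u} [SmallCategory D] {B : Type u}
  {K : Type u} [SmallCategory K] (j : K ⥤ D) [j.Full] (s : B → K)
  (hepi : ∀ {v w : D} (k : v ⟶ w), Epi k)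

variable {j s} in
/-- The extension of a family of elements to all lists of arrows. -/
def extendFamily {E : RMod R K}
    (e : ∀ b, List (ArrowTo (fun b => j.obj (s b)) (j.obj (s b))) → E.obj (Opposite.op (s b)))
    {k : K} (l : List (ArrowTo (fun b => j.obj (s b)) (j.obj k))) : E.obj (Opposite.op k) :=
  (normalize l).elim 0 fun t => E.map (j.preimage t.2.1).op (e t.1 t.2.2)

variable {j s} in
theorem extendFamily_of_normalize [j.Faithful] {E : RMod R K}
    (e : ∀ b, List (ArrowTo (fun b => j.obj (s b)) (j.obj (s b))) → E.obj (Opposite.op (s b)))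
    {k : K} {l : List (ArrowTo (fun b => j.obj (s b)) (j.obj k))} {b : B} {f : k ⟶ s b}
    {m : List (ArrowTo (fun b => j.obj (s b)) (j.obj (s b)))}
    (h : normalize l = some ⟨b, j.map f, m⟩) :
    extendFamily e l = E.map f.op (e b m) := by
  rw [extendFamily, h]
  simp

-- No compatibility is required of the family `e`: pulling back leaves the list part of a
-- normalization alone and composes its arrow part, so naturality reduces to functoriality of `E`.
variable {j s} in
theorem map_extendFamily [j.Faithful] (hepi : ∀ {v w : D} (k : v ⟶ w), Epi k) {E : RMod R K}
    (e : ∀ b, List (ArrowTo (fun b => j.obj (s b)) (j.obj (s b))) → E.obj (Opposite.op (s b)))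
    {k k' : K} (f : k' ⟶ k) (l : List (ArrowTo (fun b => j.obj (s b)) (j.obj k))) :
    E.map f.op (extendFamily e l) = extendFamily e (l.map (pull (j.map f))) := by
  have := hepi (j.map f)
  rw [extendFamily, extendFamily, normalize_map_pull]
  cases normalize l with
  | none => exact map_zero _
  | some t =>
    simp only [Option.elim, Option.map_some]
    rw [← ModuleCat.comp_apply, ← E.map_comp, ← op_comp]
    congr 4
    apply j.map_injective
    simp

variable {j s} in
/-- The morphism out of the chains given by a family of elements. -/
def descFamily [j.Faithful] (n : ℕ) {E : RMod R K}
    (e : ∀ b, List (ArrowTo (fun b => j.obj (s b)) (j.obj (s b))) → E.obj (Opposite.op (s b))) :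
    j.op ⋙ chains R (fun b => j.obj (s b)) hepi n ⟶ E where
  app k := ModuleCat.ofHom
    ((Finsupp.linearCombination R (fun l => extendFamily e (k := k.unop) l)).domRestrict _)
  naturality k k' f := by
    refine chains_hom_ext hepi (w := j.obj k.unop) fun l hl => ?_
    have := hepi (j.map f.unop)
    change Finsupp.linearCombination R _ (push (pull (j.map f.unop)) (Finsupp.single l 1)) =
      E.map f (Finsupp.linearCombination R _ (Finsupp.single l 1))
    rw [push_single, Finsupp.linearCombination_single, Finsupp.linearCombination_single, one_smul,
      one_smul]
    exact (map_extendFamily hepi e f.unop l).symm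

variable {j s} in
theorem descFamily_basisChain [j.Faithful] {n : ℕ} {E : RMod R K}
    (e : ∀ b, List (ArrowTo (fun b => j.obj (s b)) (j.obj (s b))) → E.obj (Opposite.op (s b)))
    {k : K} {l : List (ArrowTo (fun b => j.obj (s b)) (j.obj k))}
    (hl : l ∈ cells (fun b => j.obj (s b)) (n + 1) (j.obj k)) :
    (descFamily hepi n e).app (Opposite.op k) (basisChain hepi hl) = extendFamily e l := by
  change Finsupp.linearCombination R _ (Finsupp.single l 1) = _
  rw [Finsupp.linearCombination_single, one_smul]

variable {j s} in
/-- Morphisms out of the chains agree if they agree on the chains based at the objects of the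
family. -/
theorem restricted_chains_hom_ext {n : ℕ} {E : RMod R K}
    {α β : j.op ⋙ chains R (fun b => j.obj (s b)) hepi n ⟶ E}
    (h : ∀ b (l : List (ArrowTo (fun b => j.obj (s b)) (j.obj (s b))))
      (hl : l ∈ cells (fun b => j.obj (s b)) (n + 1) (j.obj (s b))),
      α.app (Opposite.op (s b)) (basisChain hepi hl) =
        β.app (Opposite.op (s b)) (basisChain hepi hl)) : α = β := by
  ext k : 2
  refine chains_hom_ext hepi (w := j.obj k.unop) fun l hl => ?_
  obtain ⟨b, f, m, -, hm, rfl⟩ := exists_normalize hepi hl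
  obtain ⟨f, rfl⟩ := j.map_surjective f
  have hα := ModuleCat.hom_ext_iff.1 (α.naturality f.op)
  have hβ := ModuleCat.hom_ext_iff.1 (β.naturality f.op)
  rw [← map_basisChain hepi (j.map f) hm]
  refine (LinearMap.congr_fun hα (basisChain hepi hm)).trans
    (Eq.trans ?_ (LinearMap.congr_fun hβ (basisChain hepi hm)).symm)
  exact congrArg (E.map f.op) (h b m hm)

/-- Lifts of the values on basis chains at the objects of the family may be chosen freely and then
extended. The generality in `j` covers two cases: the identity of `D` and the inclusion of the
subcategory. -/
theorem projective_restricted_chains [j.Faithful] (n : ℕ) :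
    Projective (j.op ⋙ chains R (fun b => j.obj (s b)) hepi n) where
  factors {E F} α p _ := by
    classical
    have hp : ∀ k, Function.Surjective (p.app k) := fun k =>
      (ModuleCat.epi_iff_surjective _).1 inferInstance
    refine ⟨descFamily hepi n fun b m =>
      if hm : m ∈ cells (fun b => j.obj (s b)) (n + 1) (j.obj (s b)) then
        (hp (Opposite.op (s b)) (α.app (Opposite.op (s b)) (basisChain hepi hm))).choose else 0, ?_⟩
    ext k : 2
    refine chains_hom_ext hepi (w := j.obj k.unop) fun l hl => ?_
    obtain ⟨b, f, m, h, hm, hm'⟩ := exists_normalize hepi hl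
    obtain ⟨f, rfl⟩ := j.map_surjective f
    refine (congrArg (p.app k) ((descFamily_basisChain hepi _ hl).trans
      (extendFamily_of_normalize _ h))).trans ?_
    rw [dif_pos hm]
    refine (LinearMap.congr_fun (ModuleCat.hom_ext_iff.1 (p.naturality f.op)) _).trans ?_
    refine (congrArg (F.map f.op) (hp _ (α.app _ (basisChain hepi hm))).choose_spec).trans ?_
    refine (LinearMap.congr_fun (ModuleCat.hom_ext_iff.1 (α.naturality f.op)) _).symm.trans ?_
    refine congrArg (α.app k) ?_
    subst hm'
    exact map_basisChain hepi (j.map f) hm hl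

end Restriction

section Comparison

variable {R : Type u} [CommRing R] {D K : Type u} [SmallCategory D] [SmallCategory K]
  (ι : K ⥤ D) (hepi : ∀ {v w : D} (k : v ⟶ w), Epi k)

theorem projective_chains (n : ℕ) : Projective (chains R ι.obj hepi n) :=
  projective_restricted_chains (𝟭 D) ι.obj hepi n

/-- Morphisms out of the chains are determined by their restriction to the subcategory. -/
theorem whiskerLeft_chains_bijective [ι.Full] (n : ℕ) (F : RMod R D) :
    Function.Bijective fun α : chains R ι.obj hepi n ⟶ F =>
      ((Functor.whiskeringLeft _ _ (ModuleCat.{u} R)).obj ι.op).map α := by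
  constructor
  · intro α β h
    refine restricted_chains_hom_ext (j := 𝟭 D) (s := ι.obj) hepi fun b l hl => ?_
    exact congrArg (fun γ => γ.app (Opposite.op b) (basisChain hepi hl)) h
  · intro γ
    classical
    -- These are the values of `γ` on the generators. At an object of the subcategory fullness makes
    -- the arrow of a normalization a morphism there, so naturality of `γ` recovers its other
    -- values.
    let e : ∀ b, List (ArrowTo ι.obj (ι.obj b)) → F.obj (Opposite.op (ι.obj b)) := fun b m =>
      if hm : m ∈ cells ι.obj (n + 1) (ι.obj b) then γ.app (Opposite.op b) (basisChain hepi hm)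
      else 0
    refine ⟨descFamily (j := 𝟭 D) (s := ι.obj) hepi n e, ?_⟩
    ext k : 2
    refine chains_hom_ext hepi (w := ι.obj k.unop) fun l hl => ?_
    obtain ⟨b, f, m, h, hm, hm'⟩ := exists_normalize hepi hl
    obtain ⟨f, rfl⟩ := ι.map_surjective f
    refine ((descFamily_basisChain (j := 𝟭 D) (s := ι.obj) hepi e hl).trans
      (extendFamily_of_normalize (j := 𝟭 D) (s := ι.obj) (f := ι.map f) e h)).trans ?_
    have he : e b m = γ.app (Opposite.op b) (basisChain hepi hm) := dif_pos hm
    rw [he]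
    refine (LinearMap.congr_fun (ModuleCat.hom_ext_iff.1 (γ.naturality f.op)) _).symm.trans ?_
    refine congrArg (γ.app k) ?_
    subst hm'
    exact map_basisChain hepi (ι.map f) hm hl

end Comparison

end

end ArrowChain

/-! ### Contiguity and acyclicity -/

namespace ListChain

/-- Acyclicity is inherited along maps of vertices which are inverse up to contiguity. -/
theorem IsAcyclic.of_contiguous {R : Type*} [CommRing R] {V W : Type*} {r : V → V → Prop}
    {q : W → W → Prop} (h : IsAcyclic R q) (p : V → W) (s : W → V)
    (hp : ∀ a b, r a b → q (p a) (p b)) (hs : ∀ a b, q a b → r (s a) (s b))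
    (h1 : ∀ a b, r a b → r (s (p a)) b) (h2 : ∀ a b, r a b → r a (s (p b))) : IsAcyclic R r := by
  intro z hz hbd
  have hmap : ∀ l ∈ cliques r, l.map p ∈ cliques q := by
    intro l hl
    simp only [cliques, Set.mem_ofPred_eq, List.forall_mem_map]
    exact fun a ha b hb => hp a b (hl a ha b hb)
  have hmap' : ∀ l ∈ cliques q, l.map s ∈ cliques r := by
    intro l hl
    simp only [cliques, Set.mem_ofPred_eq, List.forall_mem_map]
    exact fun a ha b hb => hs a b (hl a ha b hb)
  obtain ⟨y, hy, e⟩ := h (push p z) (push_mem hmap hz) (by rw [bd_push, hbd, map_zero])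
  -- The prism bounds the difference between `z` and its image under `s ∘ p`, and that image is
  -- bounded by `push s y`.
  refine ⟨prism (s ∘ p) id z + push s y, Submodule.add_mem _ (prism_mem ?_ hz) (push_mem hmap' hy),
    ?_⟩
  · intro l hl m hm a ha b hb
    obtain ⟨c, hc, h | h⟩ := hm a ha <;> obtain ⟨d, hd, h' | h'⟩ := hm b hb <;> rw [h, h']
    · exact hs _ _ (hp _ _ (hl c hc d hd))
    · exact h1 _ _ (hl c hc d hd)
    · exact h2 _ _ (hl c hc d hd)
    · exact hl c hc d hd
  · rw [map_add, bd_prism, bd_push, e, hbd, push_push, push_id, map_zero]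
    abel

end ListChain

/-! ### Arrows in the orbit category of sections -/

section OrbitCategory

variable {G : Type u} [Group G]

theorem Sec.conj_mul (g h : G) (S : Sec G) : S.conj (g * h) = (S.conj h).conj g := by
  apply Sec.ext
  · simp only [Sec.conj, Subgroup.map_map]
    congr 1
    ext x
    simp [mul_assoc]
  · simp only [Sec.conj, Subgroup.map_map]
    congr 1
    ext x
    simp [mul_assoc]

theorem Sec.conj_one (S : Sec G) : S.conj 1 = S := by
  apply Sec.ext <;> simp only [Sec.conj, map_one] <;> exact Subgroup.map_id _

theorem Sec.conj_mono (g : G) {S T : Sec G} (h : S ≤ T) : S.conj g ≤ T.conj g :=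
  ⟨Subgroup.map_mono h.1, Subgroup.map_mono h.2⟩

theorem Sec.conj_of_mem_top {S : Sec G} {g : G} (hg : g ∈ S.top) : S.conj g = S := by
  have key : ∀ x ∈ S.top, S.conj x ≤ S := by
    intro x hx
    rw [Sec.conj_le_iff]
    exact ⟨fun l hl => by simpa using S.conj_mem_bot (S.top.inv_mem hx) hl,
      fun v hv => S.top.mul_mem (S.top.mul_mem hx hv) (S.top.inv_mem hx)⟩
  refine le_antisymm (key g hg) ?_
  have := Sec.conj_mono g (key g⁻¹ (S.top.inv_mem hg))
  rwa [← Sec.conj_mul, mul_inv_cancel, Sec.conj_one] at this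

namespace OrbitSec

/-- Right multiplication by a representative of `f` is invertible on right cosets, so it can be
cancelled. -/
instance epi {S T : OrbitSec G} (f : S ⟶ T) : Epi f where
  left_cancellation {Q} k k' h := by
    have hc : Hom.coset k * Hom.coset f = Hom.coset k' * Hom.coset f :=
      congrArg Hom.coset h
    obtain ⟨g, hg⟩ := Hom.nonempty f
    obtain ⟨a, ha⟩ := Hom.nonempty k
    obtain ⟨b, hb⟩ := Hom.nonempty k'
    rw [Hom.comp_rep f k hg ha, Hom.comp_rep f k' hg hb, rightCoset_eq_iff] at hc
    apply Hom.ext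
    rw [Hom.coset_eq k ha, Hom.coset_eq k' hb, rightCoset_eq_iff]
    simpa [mul_assoc] using hc

/-- The morphism with representative `g`. -/
def homMk {S T : OrbitSec G} (g : G) (h : S.sec.conj g ≤ T.sec) : S ⟶ T :=
  (⟨MulOpposite.op g • (T.sec.top : Set G), g, h, rfl⟩ : Hom S T)

theorem mem_coset_homMk {S T : OrbitSec G} (g : G) (h : S.sec.conj g ≤ T.sec) :
    g ∈ Hom.coset (homMk g h) := by
  change g ∈ MulOpposite.op g • (T.sec.top : Set G)
  rw [Hom.mem_coset_op]
  simp

theorem hom_ext_of_mem {S T : OrbitSec G} {f k : S ⟶ T} {g : G} (hf : g ∈ Hom.coset f)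
    (hk : g ∈ Hom.coset k) : f = k :=
  Hom.ext (by rw [Hom.coset_eq f hf, Hom.coset_eq k hk])

theorem mul_mem_coset_comp {S T Q : OrbitSec G} (f : S ⟶ T) (k : T ⟶ Q) {g h : G}
    (hg : g ∈ Hom.coset f) (hh : h ∈ Hom.coset k) : h * g ∈ Hom.coset (f ≫ k) :=
  Set.mul_mem_mul hh hg

/-- The section `g⁻¹Tg` above `S` of a morphism `S ⟶ T` with representative `g`. -/
noncomputable def pullSec {S T : OrbitSec G} (f : S ⟶ T) : Sec G :=
  T.sec.conj (Hom.nonempty f).some⁻¹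

/-- Two representatives differ on the left by an element of `T.sec.top`, and conjugation by such an
element fixes the section. -/
theorem pullSec_eq {S T : OrbitSec G} {f : S ⟶ T} {g : G} (hg : g ∈ Hom.coset f) :
    pullSec f = T.sec.conj g⁻¹ := by
  have h := (Hom.nonempty f).some_mem
  set x := (Hom.nonempty f).some with hx
  rw [Hom.coset_eq f h, Hom.mem_coset_op] at hg
  have e : x⁻¹ = g⁻¹ * (g * x⁻¹) := by group
  rw [pullSec, ← hx, e, Sec.conj_mul, Sec.conj_of_mem_top hg]

theorem le_pullSec {S T : OrbitSec G} (f : S ⟶ T) : S.sec ≤ pullSec f := by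
  obtain ⟨g, hg⟩ := Hom.nonempty f
  rw [pullSec_eq hg]
  have := Sec.conj_mono g⁻¹ (Hom.conj_le f hg)
  rwa [← Sec.conj_mul, inv_mul_cancel, Sec.conj_one] at this

theorem pullSec_le_comp {S T Q : OrbitSec G} (f : S ⟶ T) (k : T ⟶ Q) :
    pullSec f ≤ pullSec (f ≫ k) := by
  obtain ⟨g, hg⟩ := Hom.nonempty f
  obtain ⟨h, hh⟩ := Hom.nonempty k
  rw [pullSec_eq hg, pullSec_eq (mul_mem_coset_comp f k hg hh), mul_inv_rev, Sec.conj_mul]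
  refine Sec.conj_mono _ ?_
  have := Sec.conj_mono h⁻¹ (Hom.conj_le k hh)
  rwa [← Sec.conj_mul, inv_mul_cancel, Sec.conj_one] at this

end OrbitSec

open ListChain ArrowChain

variable {C' C : Set (Sec G)} (hsub : C' ⊆ C)

theorem OrbitCat.epi {v w : OrbitCat C} (f : v ⟶ w) : Epi f where
  left_cancellation k k' h := by
    apply ObjectProperty.hom_ext
    rw [← cancel_epi f.hom]
    exact congrArg (fun l => l.hom) h

/-- The arrows from an object of the orbit category to the sections of a subcollection form an
acyclic complex if the poset of the sections above it is contractible. -/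
theorem OrbitCat.isAcyclic_comparable [Finite G] (R : Type*) [CommRing R] (w : OrbitCat C)
    [ContractibleSpace (posetRealization {w' : Sec G // w' ∈ C' ∧ w.obj.sec ≤ w'})]
    (hC' : IsCollection C') : IsAcyclic R (Comparable (OrbitCat.map hsub).obj w) := by
  -- The map `p` replaces the target of an arrow by its conjugate above `w`, which stays in `C'` by
  -- closure under conjugation. The map `s` sends a section above `w` to the coset of `1`.
  let p : ArrowTo (OrbitCat.map hsub).obj w → {w' : Sec G // w' ∈ C' ∧ w.obj.sec ≤ w'} := fun x =>
    ⟨OrbitSec.pullSec x.2.hom, hC' _ x.1.property _, OrbitSec.le_pullSec x.2.hom⟩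
  let s : {w' : Sec G // w' ∈ C' ∧ w.obj.sec ≤ w'} → ArrowTo (OrbitCat.map hsub).obj w := fun q =>
    ⟨⟨⟨q.1⟩, q.2.1⟩, ObjectProperty.homMk (OrbitSec.homMk 1 (by rw [Sec.conj_one]; exact q.2.2))⟩
  have hp : ∀ a b, Factors a b → p a ≤ p b := by
    rintro ⟨b, f⟩ ⟨c, g⟩ ⟨h, e⟩
    have e : f ≫ h = g := e
    have e' : OrbitSec.pullSec (f.hom ≫ h.hom) = OrbitSec.pullSec g.hom :=
      congrArg (fun k : w ⟶ (OrbitCat.map hsub).obj c => OrbitSec.pullSec k.hom) e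
    exact (OrbitSec.pullSec_le_comp f.hom h.hom).trans_eq e'
  have hs : ∀ a b, a ≤ b → Factors (s a) (s b) := by
    intro a b hab
    have e1 : w.obj.sec.conj 1 ≤ a.1 := by rw [Sec.conj_one]; exact a.2.2
    have e2 : a.1.conj 1 ≤ b.1 := by rw [Sec.conj_one]; exact hab
    have e3 : w.obj.sec.conj 1 ≤ b.1 := by rw [Sec.conj_one]; exact b.2.2
    have e : OrbitSec.homMk (S := w.obj) (T := ⟨a.1⟩) 1 e1 ≫ OrbitSec.homMk (T := ⟨b.1⟩) 1 e2 =
        OrbitSec.homMk 1 e3 := by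
      refine OrbitSec.hom_ext_of_mem (g := 1 * 1) (OrbitSec.mul_mem_coset_comp _ _
        (OrbitSec.mem_coset_homMk _ _) (OrbitSec.mem_coset_homMk _ _)) ?_
      rw [one_mul]
      exact OrbitSec.mem_coset_homMk _ _
    exact ⟨ObjectProperty.homMk (OrbitSec.homMk 1 e2), ObjectProperty.hom_ext _ e⟩
  -- Conjugation by a representative `g` relates the target of `a` to that of `s (p a)`; the cosets
  -- of `g` and `g⁻¹` give the two factorizations.
  have h1 : ∀ a, Factors (s (p a)) a := by
    rintro ⟨b, f⟩
    obtain ⟨g, hg⟩ := OrbitSec.Hom.nonempty f.hom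
    have e : (OrbitSec.pullSec f.hom).conj g ≤ b.obj.sec := by
      rw [OrbitSec.pullSec_eq hg, ← Sec.conj_mul, mul_inv_cancel, Sec.conj_one]
      exact le_rfl
    have e' : w.obj.sec.conj 1 ≤ OrbitSec.pullSec f.hom := by
      rw [Sec.conj_one]
      exact OrbitSec.le_pullSec f.hom
    have e'' : OrbitSec.homMk (S := w.obj) (T := ⟨OrbitSec.pullSec f.hom⟩) 1 e' ≫
        OrbitSec.homMk g e = f.hom := by
      refine OrbitSec.hom_ext_of_mem (g := g * 1) (OrbitSec.mul_mem_coset_comp _ _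
        (OrbitSec.mem_coset_homMk _ _) (OrbitSec.mem_coset_homMk _ _)) ?_
      rwa [mul_one]
    exact ⟨ObjectProperty.homMk (OrbitSec.homMk g e), ObjectProperty.hom_ext _ e''⟩
  have h2 : ∀ a, Factors a (s (p a)) := by
    rintro ⟨b, f⟩
    obtain ⟨g, hg⟩ := OrbitSec.Hom.nonempty f.hom
    have e : b.obj.sec.conj g⁻¹ ≤ OrbitSec.pullSec f.hom := (OrbitSec.pullSec_eq hg).ge
    have e' : w.obj.sec.conj 1 ≤ OrbitSec.pullSec f.hom := by
      rw [Sec.conj_one]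
      exact OrbitSec.le_pullSec f.hom
    have e'' : f.hom ≫ OrbitSec.homMk (T := ⟨OrbitSec.pullSec f.hom⟩) g⁻¹ e =
        OrbitSec.homMk 1 e' := by
      refine OrbitSec.hom_ext_of_mem (g := g⁻¹ * g) (OrbitSec.mul_mem_coset_comp _ _
        hg (OrbitSec.mem_coset_homMk _ _)) ?_
      rw [inv_mul_cancel]
      exact OrbitSec.mem_coset_homMk _ _
    exact ⟨ObjectProperty.homMk (OrbitSec.homMk g⁻¹ e), ObjectProperty.hom_ext _ e''⟩
  refine (isAcyclic_of_contractibleSpace R).of_contiguous p s (fun a b => Or.imp (hp a b) (hp b a))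
    (fun a b => Or.imp (hs a b) (hs b a)) (fun a b => ?_) (fun a b => ?_)
  · exact Or.imp (h1 a).trans (fun h => h.trans (h2 a))
  · exact Or.imp (fun h => h.trans (h2 b)) (h1 b).trans

end OrbitCategory

/-! ### Comparison of cohomology and of limits -/

noncomputable section

open Abelian ListChain ArrowChain

/-- Bijectivity of the map induced on extension groups only depends on the isomorphism class of
the first argument. -/
theorem mapExt_bijective_of_iso {A : Type*} [Category* A] [Abelian A] {B : Type*} [Category* B]
    [Abelian B] (Φ : A ⥤ B) [Φ.Additive] [PreservesFiniteLimits Φ] [PreservesFiniteColimits Φ]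
    [HasExt A] [HasExt B] {X X' Y : A} (e : X ≅ X') {n : ℕ}
    (h : Function.Bijective (Φ.mapExtAddHom X' Y n)) :
    Function.Bijective (Φ.mapExtAddHom X Y n) := by
  constructor
  · intro x y hxy
    have key : (Ext.mk₀ e.inv).comp x (zero_add n) = (Ext.mk₀ e.inv).comp y (zero_add n) := by
      apply h.1
      simp only [Functor.mapExtAddHom_coe, Ext.mapExactFunctor_comp] at hxy ⊢
      rw [hxy]
    have := congrArg (fun z => (Ext.mk₀ e.hom).comp z (zero_add n)) key
    simpa using this
  · intro y
    obtain ⟨x, hx⟩ := h.2 ((Ext.mk₀ (Φ.map e.inv)).comp y (zero_add n))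
    refine ⟨(Ext.mk₀ e.hom).comp x (zero_add n), ?_⟩
    simp only [Functor.mapExtAddHom_coe] at hx ⊢
    rw [Ext.mapExactFunctor_comp, hx, Ext.mapExactFunctor_mk₀]
    simp [← Functor.map_comp]

section Restriction

variable {R : Type u} [CommRing R] {D K : Type u} [SmallCategory D] [SmallCategory K] (ι : K ⥤ D)

/-- Restriction of modules along a functor. -/
abbrev RMod.restriction (R : Type u) [CommRing R] : RMod R D ⥤ RMod R K :=
  (Functor.whiskeringLeft _ _ (ModuleCat.{u} R)).obj ι.op

instance : (RMod.restriction ι R).Additive where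

instance : (RMod.restriction ι R).Linear R where

/-- The constant module is isomorphic to the augmentation module of the chains of arrows. -/
def constModIso {B : Type u} (o : B → D) (hepi : ∀ {v w : D} (k : v ⟶ w), Epi k) :
    constMod R D ≅ cycles R o hepi 0 :=
  have hmem : ∀ (w : D) (r : R), Finsupp.single [] r ∈
      Finsupp.supported R R (cells o 0 w) ⊓ LinearMap.ker bd := fun w r =>
    ⟨Finsupp.single_mem_supported _ _ ⟨by simp [cliques], rfl⟩, 
      LinearMap.mem_ker.2 (by
        rw [← Finsupp.smul_single_one, map_smul, bd_single, bdList, smul_zero])⟩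
  NatIso.ofComponents (fun w => LinearEquiv.toModuleIso
    (X₂ := ↥(Finsupp.supported R R (cells o 0 w.unop) ⊓ LinearMap.ker bd))
    { toFun := fun r : R => ⟨Finsupp.single [] r, hmem w.unop r⟩
      map_add' := fun a b : R => Subtype.ext (Finsupp.single_add _ _ _)
      map_smul' := fun a b : R => Subtype.ext (Finsupp.smul_single a [] b).symm
      invFun := fun z => z.1 []
      left_inv := fun r : R => Finsupp.single_eq_same
      right_inv := fun z => Subtype.ext (by
        ext l
        rcases l with _ | ⟨a, l⟩
        · simp
        · rw [Finsupp.single_eq_of_ne (by simp)]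
          by_contra h
          exact absurd (z.2.1 (Finsupp.mem_support_iff.2 (Ne.symm h))).2 (by simp)) })
    (fun k => ModuleCat.hom_ext (LinearMap.ext fun r => Subtype.ext
      (push_single (R := R) (pull k.unop) [] r).symm))

/-- Restriction induces bijections on cohomology if the complexes of arrows are acyclic. -/
theorem restriction_mapExt_bijective [ι.Full] [ι.Faithful]
    (hepi : ∀ {v w : D} (k : v ⟶ w), Epi k)
    (h : ∀ w : D, IsAcyclic R (Comparable ι.obj w)) (F : RMod R D) (n : ℕ) :
    Function.Bijective ((RMod.restriction ι R).mapExtAddHom (constMod R D) F n) := by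
  -- The syzygy of index `0` consists of the multiples of the empty list, that is, of the constant
  -- module; hence the final argument `0`.
  have key := mapExt_bijective_of_resolution (RMod.restriction ι R) F
    (cyclesComplex R ι.obj hepi) (cyclesComplex_shortExact R ι.obj hepi h) (fun _ => rfl)
    (projective_chains ι hepi) (projective_restricted_chains ι id hepi)
    (fun m => whiskerLeft_chains_bijective ι hepi m F) n 0
  exact mapExt_bijective_of_iso _ (constModIso ι.obj hepi) key

/-- Restriction induces bijections on morphisms out of the constant module if the complexes of
arrows are acyclic. -/
theorem restriction_map_bijective [ι.Full] [ι.Faithful]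
    (hepi : ∀ {v w : D} (k : v ⟶ w), Epi k)
    (h : ∀ w : D, IsAcyclic R (Comparable ι.obj w)) (F : RMod R D) :
    Function.Bijective fun α : constMod R D ⟶ F => (RMod.restriction ι R).map α := by
  have := restriction_mapExt_bijective ι hepi h F 0
  rw [Functor.mapExtAddHom_coe, Ext.mapExactFunctor₀] at this
  exact (Equiv.bijective_comp _ _).1 ((Equiv.comp_bijective _ _).1 this)

/-- Restriction along a functor which is bijective on morphisms out of the constant module induces
isomorphisms on limits. -/
theorem isIso_limit_pre (F : RMod R D)
    (h : Function.Bijective fun α : constMod R D ⟶ F => (RMod.restriction ι R).map α) :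
    IsIso (limit.pre F ι.op) := by
  -- Elements of the limit are morphisms from `R` into it, hence cones with vertex `R`, hence
  -- morphisms out of the constant module.
  let cone : (ModuleCat.of R R ⟶ limit F) → (constMod R D ⟶ F) := fun f =>
    (Functor.const _).map f ≫ (limit.cone F).π
  have hmk : ∀ x y : (limit (ι.op ⋙ F) : ModuleCat.{u} R),
      ModuleCat.ofHom (LinearMap.toSpanSingleton R _ x) =
        ModuleCat.ofHom (LinearMap.toSpanSingleton R _ y) → x = y := fun x y hxy => by
    simpa using LinearMap.congr_fun (ModuleCat.hom_ext_iff.1 hxy) (1 : R)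
  have hinj : ∀ f g : ModuleCat.of R R ⟶ limit F, f ≫ limit.pre F ι.op = g ≫ limit.pre F ι.op →
      f = g := by
    intro f g hfg
    have : cone f = cone g := by
      apply h.1
      ext k : 2
      have := congrArg (fun t => t ≫ limit.π (ι.op ⋙ F) k) hfg
      simpa [cone] using this
    refine limit.hom_ext fun w => ?_
    simpa [cone] using congrArg (fun t => t.app w) this
  rw [ConcreteCategory.isIso_iff_bijective]
  constructor
  · intro x y hxy
    have := hinj (ModuleCat.ofHom (LinearMap.toSpanSingleton R _ x))
      (ModuleCat.ofHom (LinearMap.toSpanSingleton R _ y)) (by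
        refine ModuleCat.hom_ext (LinearMap.ext_ring ?_)
        simpa using hxy)
    simpa using LinearMap.congr_fun (ModuleCat.hom_ext_iff.1 this) (1 : R)
  · intro y
    let g : ModuleCat.of R R ⟶ limit (ι.op ⋙ F) :=
      ModuleCat.ofHom (LinearMap.toSpanSingleton R _ y)
    obtain ⟨α, hα⟩ := h.2 ((Functor.const _).map g ≫ (limit.cone (ι.op ⋙ F)).π)
    let f : ModuleCat.of R R ⟶ limit F := limit.lift F ⟨_, α⟩
    have hf : f ≫ limit.pre F ι.op = g := by
      refine limit.hom_ext fun k => ?_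
      rw [Category.assoc, limit.pre_π, limit.lift_π]
      simpa using congrArg (fun t => t.app k) hα
    refine ⟨f (1 : R), ?_⟩
    simpa [g] using LinearMap.congr_fun (ModuleCat.hom_ext_iff.1 hf) (1 : R)

end Restriction

/-! ### Application to collections of sections -/

section Sections

variable {G : Type u} [Group G] {R : Type u} [CommRing R] {C' C : Set (Sec G)} (hsub : C' ⊆ C)

/-- This triangle turns an isomorphism of the limits into isomorphisms of the kernels and of the
cokernels of the detection maps. -/
theorem detectionMap_comp_pre (F : RMod R (OrbitSec G)) :
    detectionMap C F ≫ limit.pre (F.restrict C) (OrbitCat.map hsub).op = detectionMap C' F := by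
  refine limit.hom_ext fun S => ?_
  rw [Category.assoc, limit.pre_π]
  exact (limit.lift_π (defresCone C F) _).trans (limit.lift_π (defresCone C' F) S).symm

variable [Finite G]

theorem OrbitCat.isAcyclic (R : Type u) [CommRing R] (hsub : C' ⊆ C)
    (hC' : IsCollection C') (hcontr : ∀ w ∈ C,
      ContractibleSpace (posetRealization {w' : Sec G // w' ∈ C' ∧ w ≤ w'}))
    (w : OrbitCat C) : IsAcyclic R (Comparable (OrbitCat.map hsub).obj w) :=
  have := hcontr w.obj.sec w.property
  OrbitCat.isAcyclic_comparable hsub R w hC'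

/-- The comparison isomorphism in cohomology. -/
def cohomologyIso (hC' : IsCollection C') (hcontr : ∀ w ∈ C,
      ContractibleSpace (posetRealization {w' : Sec G // w' ∈ C' ∧ w ≤ w'}))
    (F : RMod R (OrbitCat C)) (n : ℕ) :
    cohomology F n ≅ cohomology ((OrbitCat.map hsub).op ⋙ F) n :=
  (LinearEquiv.ofBijective
    ((RMod.restriction (OrbitCat.map hsub) R).mapExtLinearMap R (constMod R (OrbitCat C)) F n)
    (restriction_mapExt_bijective _ OrbitCat.epi
      (OrbitCat.isAcyclic R hsub hC' hcontr) F n)).toModuleIso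

theorem isIso_limit_pre_restrict (hC' : IsCollection C') (hcontr : ∀ w ∈ C,
      ContractibleSpace (posetRealization {w' : Sec G // w' ∈ C' ∧ w ≤ w'}))
    (F : RMod R (OrbitSec G)) : IsIso (limit.pre (F.restrict C) (OrbitCat.map hsub).op) :=
  isIso_limit_pre _ _ (restriction_map_bijective _ OrbitCat.epi
    (OrbitCat.isAcyclic R hsub hC' hcontr) _)

/-- The comparison isomorphism in reduced cohomology. -/
def reducedCohomologyIso (hC' : IsCollection C') (hcontr : ∀ w ∈ C,
      ContractibleSpace (posetRealization {w' : Sec G // w' ∈ C' ∧ w ≤ w'}))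
    (F : RMod R (OrbitSec G)) :
    ∀ n : ℤ, reducedCohomology C F n ≅ reducedCohomology C' F n
  | .negSucc 0 =>
    have := isIso_limit_pre_restrict hsub hC' hcontr F
    kernel.mapIso (detectionMap C F) (detectionMap C' F) (Iso.refl _)
      (asIso (limit.pre (F.restrict C) (OrbitCat.map hsub).op))
      ((detectionMap_comp_pre hsub F).trans (Category.id_comp _).symm)
  | .negSucc (_ + 1) => Iso.refl _
  | .ofNat 0 =>
    have := isIso_limit_pre_restrict hsub hC' hcontr F
    cokernel.mapIso (detectionMap C F) (detectionMap C' F) (Iso.refl _)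
      (asIso (limit.pre (F.restrict C) (OrbitCat.map hsub).op))
      ((detectionMap_comp_pre hsub F).trans (Category.id_comp _).symm)
  | .ofNat (n + 1) => cohomologyIso hsub hC' hcontr (F.restrict C) (n + 1)

end Sections

end

theorem mainTheorem11 {G : Type u} [Group G] [Finite G] (R : Type u) [CommRing R]
    (C' C : Set (Sec G)) (hC' : IsCollection C') (hC : IsCollection C) (hsub : C' ⊆ C)
    (hcontr : ∀ w ∈ C,
      ContractibleSpace (posetRealization {w' : Sec G // w' ∈ C' ∧ w ≤ w'})) :
    (∀ (F : RMod R (OrbitCat C)) (n : ℕ),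
      Nonempty (cohomology F n ≅ cohomology ((OrbitCat.map hsub).op ⋙ F) n)) ∧
    (∀ (F : RMod R (OrbitSec G)) (n : ℤ),
      Nonempty (reducedCohomology C F n ≅ reducedCohomology C' F n)) ∧
    (∀ F : BisetFunctor R G, Nonempty (F.obs C ≅ F.obs C')) :=
  ⟨fun F n => ⟨cohomologyIso hsub hC' hcontr F n⟩,
    fun F n => ⟨reducedCohomologyIso hsub hC' hcontr F n⟩,
    -- The obstruction group is by definition the reduced cohomology in degree zero.
    fun F => ⟨reducedCohomologyIso hsub hC' hcontr F.toRMod 0⟩⟩
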